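/- Let $N\ge 1$, let $\Omega\subset\mathbb{R}^N$ be a smooth bounded domain, $1\le p\le\infty$, and let $q$ be the conjugate exponent of $p$. Let $J:\mathbb{R}^N\times\mathbb{R}^N\to[0,\infty)$ be a measurable symmetric kernel with $\int_{\mathbb{R}^N}J(x,y)\,dy=1$ for all $x$ and $\sup_{x\in\Omega}\|J(x,\cdot)\|_{L^q(\Omega)}<\infty$. Assume that $J$ has a measurable (weak) gradient $\partial_xJ$ in its first variable, i.e. for a.e. $y\in\Omega$ the function $\partial_xJ(\cdot,y)$ is the weak gradient of $J(\cdot,y)$ in $\Omega$, and that $\sup_{x\in\Omega}\|\partial_xJ(x,\cdot)\|_{L^q(\Omega)}<\infty$. Let $g:\mathbb{R}\times\mathbb{R}\to\mathbb{R}$ be of class $C^1$ with $$|g(t,x)|\le k_2+k_1|x|\qquad\text{for all } t,x\in\mathbb{R},$$ where $k_1<1$ and $k_2$ are constants, and suppose that for every $R$ the partial derivative $D_2g(t,x)$ is bounded on $\{|x|\le R\}$, uniformly in $t\in\mathbb{R}$. Let $X=L^p(\Omega)$, whose elements are extended by zero outside $\Omega$, and $Ku(x)=\int_{\mathbb{R}^N}J(x,y)u(y)\,dy$.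 Then the equation $$\partial_tu=-u+g(t,Ku)\quad\text{in }\Omega,\qquad u(\tau)=u_\tau\in X,$$ generates an evolution process $\{S(t,\tau):t\ge\tau\}$ in $X$: for all $\tau\in\mathbb{R}$ and $u_\tau\in X$ there is a solution $t\mapsto S(t,\tau)u_\tau$ on $[\tau,\infty)$ (continuous into $X$, with derivative in $X$), it agrees with every solution on an interval $[\tau,s)$ with the same initial value, $S(t,t)=I$, $S(t,\tau)=S(t,s)S(s,\tau)$ for $\tau\le s\le t$, and $(t,\tau,u)\mapsto S(t,\tau)u$ is continuous on $\{t\ge\tau\}\times X$. This process has a pullback attractor $\{\mathcal{A}(t)\}_{t\in\mathbb{R}}$: each $\mathcal{A}(t)\subset X$ is compact; $S(t,\tau)\mathcal{A}(\tau)=\mathcal{A}(t)$ for $\tau\le t$; for every $t$ and every bounded $C\subset X$, $\sup_{a\in S(t,\tau)C}\operatorname{dist}_X(a,\mathcal{A}(t))\to0$ as $\tau\to-\infty$; and $\mathcal{A}(t)\subset C(t)$ for all $t$ whenever $\{C(t)\}_{t\in\mathbb{R}}$ is a family of closed sets that attracts all bounded sets in this sense. Moreover, for every $t\in\mathbb{R}$,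 $$\mathcal{A}(t)\subset\Big\{u\in L^p(\Omega):\ \|u\|_{L^p(\Omega)}\le\frac{k_2|\Omega|^{1/p}}{1-k_1}\Big\},$$ where $|\Omega|^{1/p}$ is read as $1$ if $p=\infty$. -/

import Mathlib

open Set Filter Topology MeasureTheory
open scoped ENNReal NNReal ContDiff

/-- `Ω` is a smooth bounded domain: open, connected (in particular nonempty), bounded, and near
each boundary point it is the sublevel set `{ρ < 0}` of a smooth function `ρ` whose differential
does not vanish there. -/
structure IsSmoothBoundedDomain {N : ℕ} (Ω : Set (EuclideanSpace ℝ (Fin N))) : Prop where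
  isOpen : IsOpen Ω
  isConnected : IsConnected Ω
  isBounded : Bornology.IsBounded Ω
  smooth_boundary : ∀ x ∈ frontier Ω, ∃ (U : Set (EuclideanSpace ℝ (Fin N)))
    (ρ : EuclideanSpace ℝ (Fin N) → ℝ), IsOpen U ∧ x ∈ U ∧ ContDiffOn ℝ ∞ ρ U ∧
      (∀ y ∈ U, fderiv ℝ ρ y ≠ 0) ∧ Ω ∩ U = {y ∈ U | ρ y < 0}

/-- `G` is the weak (distributional) gradient of `f` on the open set `Ω`. -/
structure HasWeakGradientOn {N : ℕ} (Ω : Set (EuclideanSpace ℝ (Fin N)))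
    (f : EuclideanSpace ℝ (Fin N) → ℝ)
    (G : EuclideanSpace ℝ (Fin N) → EuclideanSpace ℝ (Fin N)) : Prop where
  locallyIntegrableOn : LocallyIntegrableOn f Ω volume
  locallyIntegrableOn_gradient : LocallyIntegrableOn G Ω volume
  integral_eq : ∀ φ : EuclideanSpace ℝ (Fin N) → ℝ, ContDiff ℝ ∞ φ → HasCompactSupport φ →
    tsupport φ ⊆ Ω → ∀ v : EuclideanSpace ℝ (Fin N),
      ∫ x in Ω, f x * fderiv ℝ φ x v = - ∫ x in Ω, φ x * inner ℝ (G x) v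

/-- The operator `(K u)(x) = ∫ J(x, y) u(y) dy`, where `u` is defined on `Ω` and is extended by
zero outside `Ω`, so that only `Ω` contributes to the integral over `ℝ^N`. -/
noncomputable def kernelOp {N : ℕ} (Ω : Set (EuclideanSpace ℝ (Fin N)))
    (J : EuclideanSpace ℝ (Fin N) → EuclideanSpace ℝ (Fin N) → ℝ)
    (u : EuclideanSpace ℝ (Fin N) → ℝ) (x : EuclideanSpace ℝ (Fin N)) : ℝ :=
  ∫ y in Ω, J x y * u y

/-- `u` solves `∂ₜ u = -u + g(t, K u)` on the time interval `I`, as a curve in `X = L^p(Ω)`: it is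
continuous and, at each `t ∈ I`, it has a derivative in `X` (one-sided at an end point of `I`)
that equals `x ↦ -u(t, x) + g(t, K u(t, x))` almost everywhere in `Ω`. -/
structure IsSolutionOn {N : ℕ} (Ω : Set (EuclideanSpace ℝ (Fin N))) (p : ℝ≥0∞) [Fact (1 ≤ p)]
    (J : EuclideanSpace ℝ (Fin N) → EuclideanSpace ℝ (Fin N) → ℝ) (g : ℝ → ℝ → ℝ)
    (I : Set ℝ) (u : ℝ → Lp ℝ p (volume.restrict Ω)) : Prop where
  continuousOn : ContinuousOn u I
  hasDeriv : ∀ t ∈ I, ∃ v : Lp ℝ p (volume.restrict Ω), HasDerivWithinAt u v I t ∧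
    ∀ᵐ x ∂(volume.restrict Ω), v x = - u t x + g t (kernelOp Ω J (u t) x)

/-- `S` is an evolution process in `X`; only the values `S t τ` with `τ ≤ t` are meaningful. -/
structure IsEvolutionProcess {X : Type*} [NormedAddCommGroup X] (S : ℝ → ℝ → X → X) : Prop where
  self : ∀ t x, S t t x = x
  comp : ∀ τ s t, τ ≤ s → s ≤ t → ∀ x, S t τ x = S t s (S s τ x)
  continuousOn : ContinuousOn (fun z : ℝ × ℝ × X => S z.1 z.2.1 z.2.2) {z | z.2.1 ≤ z.1}

/-- `S` is the solution process of `∂ₜ u = -u + g(t, K u)` in `L^p(Ω)`: `t ↦ S t τ u₀` solves the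
equation on `[τ, ∞)` with value `u₀` at time `τ`, and each solution on some `[τ, s)` with the same
initial value coincides with it. -/
structure IsGeneratedProcess {N : ℕ} (Ω : Set (EuclideanSpace ℝ (Fin N))) (p : ℝ≥0∞)
    [Fact (1 ≤ p)] (J : EuclideanSpace ℝ (Fin N) → EuclideanSpace ℝ (Fin N) → ℝ)
    (g : ℝ → ℝ → ℝ)
    (S : ℝ → ℝ → Lp ℝ p (volume.restrict Ω) → Lp ℝ p (volume.restrict Ω)) : Prop where
  isEvolutionProcess : IsEvolutionProcess S
  isSolution : ∀ τ u₀, IsSolutionOn Ω p J g (Ici τ) (fun t => S t τ u₀)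
  unique : ∀ τ s u₀, τ < s → ∀ w : ℝ → Lp ℝ p (volume.restrict Ω),
    IsSolutionOn Ω p J g (Ico τ s) w → w τ = u₀ → ∀ t ∈ Ico τ s, w t = S t τ u₀

/-- The Hausdorff semi-distance `sup_{a ∈ A} inf_{b ∈ B} |a - b|`, with values in `[0, ∞]`. -/
noncomputable def hausdorffSemidist {X : Type*} [NormedAddCommGroup X] (A B : Set X) : ℝ≥0∞ :=
  ⨆ a ∈ A, Metric.infEDist a B

/-- The family `K` pullback attracts bounded sets under `S`. -/
def PullbackAttracts {X : Type*} [NormedAddCommGroup X] (S : ℝ → ℝ → X → X)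
    (K : ℝ → Set X) : Prop :=
  ∀ t : ℝ, ∀ C : Set X, Bornology.IsBounded C →
    Tendsto (fun τ : ℝ => hausdorffSemidist (S t τ '' C) (K t)) atBot (𝓝 0)

/-- `A` is a pullback attractor of `S`: a family of compact sets that is invariant, pullback
attracts bounded sets, and is minimal among the closed families that do so. -/
structure IsPullbackAttractor {X : Type*} [NormedAddCommGroup X] (S : ℝ → ℝ → X → X)
    (A : ℝ → Set X) : Prop where
  isCompact : ∀ t, IsCompact (A t)
  invariant : ∀ τ t, τ ≤ t → S t τ '' A τ = A t
  attracts : PullbackAttracts S A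
  minimal : ∀ C : ℝ → Set X, (∀ t, IsClosed (C t)) → PullbackAttracts S C → ∀ t, A t ⊆ C t

/-!
The equation is treated as an ordinary differential equation `u' = -u + F(t, u)` in the Banach space
`X = L^p(Ω)`, with `F(t, u) = g(t, K u)`. Everything about the process and its attractor follows
from the properties of `F` collected in `IsDissipativeField`; the rest of the work is to verify them
for the nonlocal reaction.

*Process.* Since `F` is Lipschitz on balls and grows linearly, the Picard-Lindelöf theorem gives
solutions on intervals of a fixed length, which are glued together. Comparing `e^t ‖u‖` with a
scalar supersolution (`IsTrajectory.norm_le`) shows that the excess of `‖u‖` over `b / (1 - k)`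
decays exponentially, where `‖F(t, u)‖ ≤ b + k ‖u‖`. So balls of radius at least `b / (1 - k)` are
positively invariant, and the Lipschitz constants on such a ball give uniqueness and joint
continuity (`IsSolutionFamily.dist_le_of_norm_le`).

*Attractor.* By variation of constants, `S(t, τ) u` differs from `e^(τ - t) u` by an element of the
closed convex hull of `0` and the values of `F` on a ball (`IsSolutionFamily.sub_exp_smul_mem`).
This hull is compact, because `F` maps balls, over all times together, into totally bounded sets.
Hence states started in a ball at times tending to `-∞` have convergent subsequences, and the
pullback limit of the ball of radius `b / (1 - k) + 1` is the attractor. Its invariance and the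
decay of the norm put it into the ball of radius `b / (1 - k)`.

*Verification for `g(t, K u)`.* The operator `K` is a contraction of `L^p`, by Jensen's inequality
and Tonelli's theorem (`IsAveragingKernel.eLpNorm_integralOp_le`), which with the growth of `g`
gives `b = k₂ |Ω|^(1/p)` and `k = k₁`. By Hölder's inequality `K` maps balls of `L^p` into bounded
sets of `L^∞`, where `g` is Lipschitz. For total boundedness, `K u` has a weak gradient bounded by a
multiple of `‖u‖`. Mollification turns this into a bound on the variation of `K u` along polygons in
`Ω` (`HasBoundedWeakGradientOn.exists_approx`). A smooth bounded domain is covered by finitely many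
sets whose points are joined by short polygons inside `Ω`
(`IsSmoothBoundedDomain.exists_finite_cover`), so all functions `K u` with `‖u‖ ≤ M`, and with them
all `g(t, K u)`, have small oscillation on a common finite cover. This yields total boundedness
uniformly in `t` and for all `1 ≤ p ≤ ∞` at once (`totallyBounded_Lp_of_oscillation`).
-/

/-! ### Damped ordinary differential equations in a Banach space -/

/-- A time-dependent field `F` on a Banach space for which `u' = -u + F(t, u)` is dissipative and
asymptotically compact: `F` is continuous in time, Lipschitz on balls uniformly in time, grows at
most like `b + k ‖u‖` with `k < 1`, and maps each ball, over all times together, into a totally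
bounded set. -/
structure IsDissipativeField {X : Type*} [NormedAddCommGroup X] (F : ℝ → X → X) (b k : ℝ) :
    Prop where
  b_nonneg : 0 ≤ b
  k_nonneg : 0 ≤ k
  k_lt_one : k < 1
  continuous_time : ∀ u, Continuous fun t => F t u
  lipschitz : ∀ M : ℝ, ∃ L : ℝ≥0, ∀ t, LipschitzOnWith L (F t) (Metric.closedBall 0 M)
  growth : ∀ t u, ‖F t u‖ ≤ b + k * ‖u‖
  totallyBounded : ∀ M : ℝ, TotallyBounded {v | ∃ t u, ‖u‖ ≤ M ∧ F t u = v}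

/-- `u` solves `u' = -u + F(t, u)` on `I`, with one-sided derivatives at end points of `I`. -/
def IsTrajectory {X : Type*} [NormedAddCommGroup X] [NormedSpace ℝ X] (F : ℝ → X → X)
    (I : Set ℝ) (u : ℝ → X) : Prop :=
  ∀ t ∈ I, HasDerivWithinAt u (-u t + F t (u t)) I t

section Trajectory

variable {X : Type*} [NormedAddCommGroup X] [NormedSpace ℝ X] {F : ℝ → X → X} {b k : ℝ}

lemma IsTrajectory.mono {I I' : Set ℝ} {u : ℝ → X} (hu : IsTrajectory F I u) (h : I' ⊆ I) :
    IsTrajectory F I' u := fun t ht => (hu t (h ht)).mono h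

lemma IsTrajectory.continuousOn {I : Set ℝ} {u : ℝ → X} (hu : IsTrajectory F I u) :
    ContinuousOn u I := fun t ht => (hu t ht).continuousWithinAt

lemma IsTrajectory.hasDerivWithinAt_Ici {a c t : ℝ} {u : ℝ → X}
    (hu : IsTrajectory F (Icc a c) u) (ht : t ∈ Ico a c) :
    HasDerivWithinAt u (-u t + F t (u t)) (Ici t) t :=
  ((hu t ⟨ht.1, ht.2.le⟩).mono (Icc_subset_Icc_left ht.1)).mono_of_mem_nhdsWithin
    (Icc_mem_nhdsGE ht.2)

/-- Dissipativity: the excess of the norm over the equilibrium bound `b / (1 - k)` decays. -/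
lemma IsTrajectory.norm_le (hF : IsDissipativeField F b k) {a c : ℝ} {u : ℝ → X}
    (hu : IsTrajectory F (Icc a c) u) {d : ℝ} (hua : ‖u a‖ ≤ b / (1 - k) + d)
    {t : ℝ} (ht : t ∈ Icc a c) :
    ‖u t‖ ≤ b / (1 - k) + d * Real.exp (-(1 - k) * (t - a)) := by
  have hk : 0 < 1 - k := by linarith [hF.k_lt_one]
  refine le_of_forall_pos_le_add fun ε hε => ?_
  set r := b / (1 - k) + ε with hr
  have hrk : b + k * r < r := by
    have : b = (1 - k) * (b / (1 - k)) := by field_simp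
    rw [hr]; nlinarith
  -- With the integrating factor the equation reads `w' = e^(s-a) F(s, u)`, and the bound is a
  -- strict supersolution of the resulting scalar inequality.
  have key := image_norm_le_of_norm_deriv_right_lt_deriv_boundary
    (f := fun s => Real.exp (s - a) • u s)
    (f' := fun s => Real.exp (s - a) • F s (u s))
    (B := fun s => r * Real.exp (s - a) + d * Real.exp (k * (s - a)))
    (B' := fun s => r * Real.exp (s - a) + d * (Real.exp (k * (s - a)) * k)) (a := a) (b := c)
    (by
      have := hu.continuousOn
      fun_prop)
    (by
      intro s hs
      have h1 : HasDerivAt (fun s : ℝ => Real.exp (s - a)) (Real.exp (s - a)) s := by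
        simpa using ((hasDerivAt_id s).sub_const a).exp
      have := h1.hasDerivWithinAt.smul (hu.hasDerivWithinAt_Ici hs)
      convert! this using 1
      module)
    (by simp; linarith)
    (by
      intro s
      have h1 : HasDerivAt (fun s : ℝ => Real.exp (s - a)) (Real.exp (s - a)) s := by
        simpa using ((hasDerivAt_id s).sub_const a).exp
      have h2 : HasDerivAt (fun s : ℝ => Real.exp (k * (s - a)))
          (Real.exp (k * (s - a)) * k) s := by
        simpa using (((hasDerivAt_id s).sub_const a).const_mul k).exp
      exact (h1.const_mul r).add (h2.const_mul d))
    (by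
      intro s hs heq
      have hE := Real.exp_pos (s - a)
      simp only [norm_smul, Real.norm_eq_abs, abs_of_pos hE] at heq ⊢
      have := mul_le_mul_of_nonneg_left (hF.growth s (u s)) hE.le
      have h2 := mul_lt_mul_of_pos_right hrk hE
      calc _ ≤ Real.exp (s - a) * (b + k * ‖u s‖) := this
        _ = b * Real.exp (s - a) + k * (Real.exp (s - a) * ‖u s‖) := by ring
        _ = (b + k * r) * Real.exp (s - a) + d * (Real.exp (k * (s - a)) * k) := by
          rw [heq]; ring
        _ < _ := by linarith) ht
  have hE := Real.exp_pos (t - a)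
  simp only [norm_smul, Real.norm_eq_abs, abs_of_pos hE] at key
  have he : Real.exp (k * (t - a)) = Real.exp (t - a) * Real.exp (-(1 - k) * (t - a)) := by
    rw [← Real.exp_add]; congr 1; ring
  rw [he] at key
  have : Real.exp (t - a) * ‖u t‖ ≤
      Real.exp (t - a) * (r + d * Real.exp (-(1 - k) * (t - a))) := by
    linarith
  have := le_of_mul_le_mul_left this hE
  rw [hr] at this
  linarith

lemma IsTrajectory.norm_le_of_le (hF : IsDissipativeField F b k) {a c M : ℝ} {u : ℝ → X}
    (hu : IsTrajectory F (Icc a c) u) (hM : b / (1 - k) ≤ M) (hua : ‖u a‖ ≤ M)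
    {t : ℝ} (ht : t ∈ Icc a c) : ‖u t‖ ≤ M := by
  have hk : 0 < 1 - k := by linarith [hF.k_lt_one]
  have h := hu.norm_le hF (d := M - b / (1 - k)) (by linarith) ht
  have he : Real.exp (-(1 - k) * (t - a)) ≤ 1 :=
    Real.exp_le_one_iff.2 (by nlinarith [ht.1])
  nlinarith

lemma IsTrajectory.dist_le (hF : IsDissipativeField F b k) {a c M : ℝ} {L : ℝ≥0}
    (hL : ∀ t, LipschitzOnWith L (F t) (Metric.closedBall 0 M)) (hM : b / (1 - k) ≤ M)
    {u v : ℝ → X} (hu : IsTrajectory F (Icc a c) u) (hv : IsTrajectory F (Icc a c) v)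
    (hua : ‖u a‖ ≤ M) (hva : ‖v a‖ ≤ M) {t : ℝ} (ht : t ∈ Icc a c) :
    dist (u t) (v t) ≤ dist (u a) (v a) * Real.exp ((1 + L) * (t - a)) := by
  have := dist_le_of_trajectories_ODE_of_mem (v := fun t x => -x + F t x) (K := 1 + L)
    (s := fun _ => Metric.closedBall 0 M) (f := u) (g := v) (a := a) (b := c)
    (δ := dist (u a) (v a))
    (fun t _ => by
      have h1 : LipschitzOnWith 1 (fun x : X => -x) (Metric.closedBall 0 M) :=
        (LipschitzWith.id.neg).lipschitzOnWith
      exact h1.add (hL t))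
    hu.continuousOn (fun t ht => hu.hasDerivWithinAt_Ici ht)
    (fun t ht => by simpa using hu.norm_le_of_le hF hM hua ⟨ht.1, ht.2.le⟩)
    hv.continuousOn (fun t ht => hv.hasDerivWithinAt_Ici ht)
    (fun t ht => by simpa using hv.norm_le_of_le hF hM hva ⟨ht.1, ht.2.le⟩) le_rfl t ht
  simpa using this

lemma IsTrajectory.eqOn (hF : IsDissipativeField F b k) {a c : ℝ} {u v : ℝ → X}
    (hu : IsTrajectory F (Icc a c) u) (hv : IsTrajectory F (Icc a c) v) (h : u a = v a) :
    EqOn u v (Icc a c) := by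
  intro t ht
  obtain ⟨L, hL⟩ := hF.lipschitz (max (b / (1 - k)) ‖u a‖)
  have := IsTrajectory.dist_le hF hL (le_max_left _ _) hu hv (le_max_right _ _)
    (by rw [← h]; exact le_max_right _ _) ht
  rw [h, dist_self, zero_mul] at this
  exact dist_le_zero.1 this

lemma IsTrajectory.dist_time_le (hF : IsDissipativeField F b k) {a c M : ℝ} {u : ℝ → X}
    (hu : IsTrajectory F (Icc a c) u) (hM : b / (1 - k) ≤ M) (hua : ‖u a‖ ≤ M) (hac : a ≤ c) :
    dist (u c) (u a) ≤ (b + 2 * M) * (c - a) := by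
  have hM0 : 0 ≤ M := (norm_nonneg _).trans hua
  rw [dist_eq_norm]
  refine norm_image_sub_le_of_norm_deriv_right_le_segment hu.continuousOn
    (fun t ht => hu.hasDerivWithinAt_Ici ht) (fun t ht => ?_) c ⟨hac, le_rfl⟩
  have h1 := hu.norm_le_of_le hF hM hua ⟨ht.1, ht.2.le⟩
  have h2 := hF.growth t (u t)
  have h3 := norm_add_le (-u t) (F t (u t))
  rw [norm_neg] at h3
  nlinarith [hF.k_nonneg, hF.k_lt_one, norm_nonneg (u t)]

lemma IsTrajectory.glue {a c e : ℝ} (hac : a ≤ c) (hce : c ≤ e) {u v : ℝ → X}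
    (hu : IsTrajectory F (Icc a c) u) (hv : IsTrajectory F (Icc c e) v) (h : v c = u c) :
    IsTrajectory F (Icc a e) (fun t => if t ≤ c then u t else v t) := by
  set w : ℝ → X := fun t => if t ≤ c then u t else v t with hw
  have hwu : ∀ t ≤ c, w t = u t := fun t ht => if_pos ht
  have hwv : ∀ t, c ≤ t → w t = v t := by
    intro t ht
    rcases ht.eq_or_lt with rfl | ht
    · rw [hwu _ le_rfl, h]
    · exact if_neg ht.not_ge
  have h1 : ∀ t ∈ Icc a c, HasDerivWithinAt w (-w t + F t (w t)) (Icc a c) t := by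
    intro t ht
    rw [hwu t ht.2]
    exact (hu t ht).congr (fun s hs => hwu s hs.2) (hwu t ht.2)
  have h2 : ∀ t ∈ Icc c e, HasDerivWithinAt w (-w t + F t (w t)) (Icc c e) t := by
    intro t ht
    rw [hwv t ht.1]
    exact (hv t ht).congr (fun s hs => hwv s hs.1) (hwv t ht.1)
  intro t ht
  rw [← Icc_union_Icc_eq_Icc hac hce]
  rcases lt_trichotomy t c with htc | rfl | htc
  · refine (h1 t ⟨ht.1, htc.le⟩).union (HasFDerivWithinAt.of_notMem_closure ?_)
    simp [htc]
  · exact (h1 t ⟨ht.1, le_rfl⟩).union (h2 t ⟨le_rfl, ht.2⟩)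
  · refine HasDerivWithinAt.union (HasFDerivWithinAt.of_notMem_closure ?_) (h2 t ⟨htc.le, ht.2⟩)
    simp [htc]

variable [CompleteSpace X]

/-- Linear growth makes the length of the existence interval independent of the initial data. -/
lemma IsDissipativeField.exists_trajectory_short (hF : IsDissipativeField F b k) (τ : ℝ) (x : X) :
    ∃ u : ℝ → X, u τ = x ∧ IsTrajectory F (Icc τ (τ + 1 / 4)) u := by
  set a : ℝ := 2 * ‖x‖ + b
  have hb := hF.b_nonneg
  have ha0 : 0 ≤ a := by positivity
  obtain ⟨L, hL⟩ := hF.lipschitz (‖x‖ + a)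
  have hball : ∀ y ∈ Metric.closedBall x a, ‖y‖ ≤ ‖x‖ + a := by
    intro y hy
    have h1 := norm_sub_norm_le y x
    rw [Metric.mem_closedBall, dist_eq_norm] at hy
    linarith
  have hP : IsPicardLindelof (fun t y => -y + F t y) (tmin := τ) (tmax := τ + 1 / 4)
      ⟨τ, by simp⟩ x ⟨a, ha0⟩ 0 ⟨4 * a, by positivity⟩ (1 + L) := by
    refine ⟨fun t _ => ?_, fun y _ => ?_, fun t _ y hy => ?_, ?_⟩
    · have h1 : LipschitzOnWith 1 (fun x : X => -x) (Metric.closedBall x a) :=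
        (LipschitzWith.id.neg).lipschitzOnWith
      refine h1.add ((hL t).mono fun y hy => ?_)
      simpa using hball y hy
    · exact (continuous_const.add (hF.continuous_time y)).continuousOn
    · have h1 := hball y hy
      have h2 := hF.growth t y
      have h3 := norm_add_le (-y) (F t y)
      rw [norm_neg] at h3
      change _ ≤ 4 * a
      nlinarith [hF.k_nonneg, hF.k_lt_one, norm_nonneg y, norm_nonneg x]
    · simp only [NNReal.coe_zero, add_sub_cancel_left, sub_self, sub_zero]
      rw [max_eq_left (by norm_num)]
      change 4 * a * (1 / 4) ≤ a
      linarith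
  obtain ⟨u, hu0, hu⟩ := hP.exists_eq_forall_mem_Icc_hasDerivWithinAt₀
  exact ⟨u, hu0, hu⟩

lemma IsDissipativeField.exists_trajectory_Icc (hF : IsDissipativeField F b k) (τ : ℝ) (x : X)
    (n : ℕ) : ∃ u : ℝ → X, u τ = x ∧ IsTrajectory F (Icc τ (τ + n / 4)) u := by
  induction n with
  | zero =>
    obtain ⟨u, hu0, hu⟩ := hF.exists_trajectory_short τ x
    exact ⟨u, hu0, hu.mono (Icc_subset_Icc_right (by norm_num))⟩
  | succ n ih =>
    obtain ⟨u, hu0, hu⟩ := ih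
    obtain ⟨v, hv0, hv⟩ := hF.exists_trajectory_short (τ + n / 4) (u (τ + n / 4))
    have hn : (0 : ℝ) ≤ n / 4 := by positivity
    refine ⟨_, ?_, (hu.glue (by linarith) (by linarith) hv hv0).mono
      (Icc_subset_Icc_right (by push_cast; linarith))⟩
    simp [hn, hu0]

lemma IsDissipativeField.exists_trajectory (hF : IsDissipativeField F b k) (τ : ℝ) (x : X) :
    ∃ u : ℝ → X, u τ = x ∧ IsTrajectory F (Ici τ) u := by
  choose u hu0 hu using hF.exists_trajectory_Icc τ x
  have hagree : ∀ m n : ℕ, m ≤ n → ∀ t ∈ Icc τ (τ + m / 4), u n t = u m t := by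
    intro m n hmn t ht
    have hmn' : (m : ℝ) ≤ n := by exact_mod_cast hmn
    exact ((hu n).mono (Icc_subset_Icc_right (by linarith))).eqOn hF (hu m)
      (by rw [hu0, hu0]) ht
  let N : ℝ → ℕ := fun t => ⌈4 * (t - τ)⌉₊
  have hN : ∀ t, t ≤ τ + N t / 4 := fun t => by
    have := Nat.le_ceil (4 * (t - τ))
    simp only [N]; linarith
  have hw : ∀ (m : ℕ), ∀ t ∈ Icc τ (τ + m / 4), u (N t) t = u m t := by
    intro m t ht
    rcases le_total m (N t) with h | h
    · exact hagree _ _ h t ht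
    · exact (hagree _ _ h t ⟨ht.1, hN t⟩).symm
  refine ⟨fun t => u (N t) t, hu0 _, fun t ht => ?_⟩
  have hlt : t < τ + (N t + 1 : ℕ) / 4 := by
    have := hN t
    push_cast; linarith
  have hmem : t ∈ Icc τ (τ + (N t + 1 : ℕ) / 4) := ⟨ht, hlt.le⟩
  have h := (hu (N t + 1) t hmem).congr (fun s hs => hw _ s hs) (hw _ t hmem)
  simp only [hw _ t hmem]
  refine h.mono_of_mem_nhdsWithin ?_
  rw [← Ici_inter_Iic]
  exact inter_mem self_mem_nhdsWithin (mem_nhdsWithin_of_mem_nhds (Iic_mem_nhds hlt))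

end Trajectory

/-- `S` is the family of solution operators of `u' = -u + F(t, u)`. -/
structure IsSolutionFamily {X : Type*} [NormedAddCommGroup X] [NormedSpace ℝ X] (F : ℝ → X → X)
    (S : ℝ → ℝ → X → X) : Prop where
  self : ∀ t x, S t t x = x
  trajectory : ∀ τ x, IsTrajectory F (Ici τ) fun t => S t τ x

section Semiflow

variable {X : Type*} [NormedAddCommGroup X] [NormedSpace ℝ X] {F : ℝ → X → X} {b k : ℝ}
  {S : ℝ → ℝ → X → X}

lemma IsDissipativeField.exists_isSolutionFamily [CompleteSpace X]
    (hF : IsDissipativeField F b k) : ∃ S, IsSolutionFamily F S := by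
  choose u hu0 hu using hF.exists_trajectory
  exact ⟨fun t τ x => u τ x t, fun t x => hu0 t x, hu⟩

lemma IsSolutionFamily.eq_of_trajectory (hS : IsSolutionFamily F S)
    (hF : IsDissipativeField F b k) {τ t : ℝ} {w : ℝ → X} (hτ : τ ≤ t)
    (hw : IsTrajectory F (Icc τ t) w) : w t = S t τ (w τ) :=
  hw.eqOn hF ((hS.trajectory τ (w τ)).mono Icc_subset_Ici_self) (hS.self _ _).symm ⟨hτ, le_rfl⟩

lemma IsSolutionFamily.comp (hS : IsSolutionFamily F S) (hF : IsDissipativeField F b k)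
    {τ s t : ℝ} (hτs : τ ≤ s) (hst : s ≤ t) (x : X) : S t τ x = S t s (S s τ x) :=
  hS.eq_of_trajectory hF hst
    ((hS.trajectory τ x).mono (Icc_subset_Ici_self.trans (Ici_subset_Ici.2 hτs)))

lemma IsSolutionFamily.norm_le (hS : IsSolutionFamily F S) (hF : IsDissipativeField F b k)
    {τ t d : ℝ} (hτ : τ ≤ t) {x : X} (hx : ‖x‖ ≤ b / (1 - k) + d) :
    ‖S t τ x‖ ≤ b / (1 - k) + d * Real.exp (-(1 - k) * (t - τ)) :=
  ((hS.trajectory τ x).mono Icc_subset_Ici_self).norm_le hF (by rwa [hS.self]) ⟨hτ, le_rfl⟩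

lemma IsSolutionFamily.norm_le_of_le (hS : IsSolutionFamily F S) (hF : IsDissipativeField F b k)
    {τ t M : ℝ} (hτ : τ ≤ t) (hM : b / (1 - k) ≤ M) {x : X} (hx : ‖x‖ ≤ M) : ‖S t τ x‖ ≤ M :=
  ((hS.trajectory τ x).mono Icc_subset_Ici_self).norm_le_of_le hF hM (by rwa [hS.self])
    ⟨hτ, le_rfl⟩

lemma IsSolutionFamily.dist_time_le (hS : IsSolutionFamily F S) (hF : IsDissipativeField F b k)
    {τ s t M : ℝ} (hτ : τ ≤ s) (hst : s ≤ t) (hM : b / (1 - k) ≤ M) {x : X} (hx : ‖x‖ ≤ M) :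
    dist (S t τ x) (S s τ x) ≤ (b + 2 * M) * (t - s) :=
  ((hS.trajectory τ x).mono
    (Icc_subset_Ici_self.trans (Ici_subset_Ici.2 hτ))).dist_time_le hF hM
    (hS.norm_le_of_le hF hτ hM hx) hst

lemma IsSolutionFamily.dist_le (hS : IsSolutionFamily F S) (hF : IsDissipativeField F b k)
    {τ t M : ℝ} {L : ℝ≥0} (hL : ∀ t, LipschitzOnWith L (F t) (Metric.closedBall 0 M))
    (hτ : τ ≤ t) (hM : b / (1 - k) ≤ M) {x y : X} (hx : ‖x‖ ≤ M) (hy : ‖y‖ ≤ M) :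
    dist (S t τ x) (S t τ y) ≤ dist x y * Real.exp ((1 + L) * (t - τ)) := by
  have := IsTrajectory.dist_le hF hL hM ((hS.trajectory τ x).mono Icc_subset_Ici_self)
    ((hS.trajectory τ y).mono Icc_subset_Ici_self) (by rwa [hS.self]) (by rwa [hS.self])
    (⟨hτ, le_rfl⟩ : t ∈ Icc τ t)
  simpa [hS.self] using this

/-- Starting later, from the same state, changes the state at time `t` at most proportionally to
the delay. -/
lemma IsSolutionFamily.dist_start_le (hS : IsSolutionFamily F S) (hF : IsDissipativeField F b k)
    {τ σ t M : ℝ} {L : ℝ≥0} (hL : ∀ t, LipschitzOnWith L (F t) (Metric.closedBall 0 M))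
    (hτ : τ ≤ σ) (hσ : σ ≤ t) (hM : b / (1 - k) ≤ M) {x : X} (hx : ‖x‖ ≤ M) :
    dist (S t τ x) (S t σ x) ≤ (b + 2 * M) * (σ - τ) * Real.exp ((1 + L) * (t - σ)) := by
  rw [hS.comp hF hτ hσ]
  refine (hS.dist_le hF hL hσ hM (hS.norm_le_of_le hF hτ hM hx) hx).trans ?_
  have := hS.dist_time_le hF le_rfl hτ hM hx
  rw [hS.self] at this
  gcongr

/-- Both flows are continued to the later final time and restarted at the later initial time, where
the estimates in each single variable apply. -/
lemma IsSolutionFamily.dist_le_of_norm_le (hS : IsSolutionFamily F S)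
    (hF : IsDissipativeField F b k)
    {M : ℝ} {L : ℝ≥0} (hL : ∀ t, LipschitzOnWith L (F t) (Metric.closedBall 0 M))
    (hM : b / (1 - k) ≤ M) {τ t τ' t' : ℝ} (hτ : τ ≤ t) (hτ' : τ' ≤ t') {x y : X}
    (hx : ‖x‖ ≤ M) (hy : ‖y‖ ≤ M) :
    dist (S t τ x) (S t' τ' y) ≤ (b + 2 * M) * |t - t'| +
      ((b + 2 * M) * |τ - τ'| + dist x y) *
        Real.exp ((1 + L) * (max t t' - max τ τ')) := by
  have hB : 0 ≤ b + 2 * M := by linarith [hF.b_nonneg, (norm_nonneg _).trans hx]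
  set T := max t t'
  set σ := max τ τ'
  have hσT : σ ≤ T := max_le_max hτ hτ'
  have h1 := hS.dist_time_le hF hτ (le_max_left t t') hM hx
  have h2 := hS.dist_time_le hF hτ' (le_max_right t t') hM hy
  have h3 := hS.dist_start_le hF hL (le_max_left τ τ') hσT hM hx
  have h4 := hS.dist_start_le hF hL (le_max_right τ τ') hσT hM hy
  have h5 := hS.dist_le hF hL hσT hM hx hy
  have e1 : (T - t) + (T - t') = |t - t'| := by
    rcases le_total t t' with h | h
    · simp only [T, max_eq_right h, abs_of_nonpos (sub_nonpos.2 h)]; ring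
    · simp only [T, max_eq_left h, abs_of_nonneg (sub_nonneg.2 h)]; ring
  have e2 : (σ - τ) + (σ - τ') = |τ - τ'| := by
    rcases le_total τ τ' with h | h
    · simp only [σ, max_eq_right h, abs_of_nonpos (sub_nonpos.2 h)]; ring
    · simp only [σ, max_eq_left h, abs_of_nonneg (sub_nonneg.2 h)]; ring
  have t1 := dist_triangle (S t τ x) (S T τ x) (S t' τ' y)
  have t2 := dist_triangle (S T τ x) (S T σ x) (S t' τ' y)
  have t3 := dist_triangle (S T σ x) (S T σ y) (S t' τ' y)
  have t4 := dist_triangle (S T σ y) (S T τ' y) (S t' τ' y)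
  rw [dist_comm (S t τ x) (S T τ x)] at t1
  rw [dist_comm (S T σ y) (S T τ' y)] at t4
  rw [← e1, ← e2]
  change dist (S T τ x) (S t τ x) ≤ _ * (T - t) at h1
  change dist (S T τ' y) (S t' τ' y) ≤ _ * (T - t') at h2
  change dist (S T τ x) (S T σ x) ≤ _ * (σ - τ) * Real.exp ((1 + ↑L) * (T - σ)) at h3
  change dist (S T τ' y) (S T σ y) ≤ _ * (σ - τ') * Real.exp ((1 + ↑L) * (T - σ)) at h4
  linarith

lemma IsSolutionFamily.isEvolutionProcess (hS : IsSolutionFamily F S)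
    (hF : IsDissipativeField F b k) : IsEvolutionProcess S := by
  refine ⟨hS.self, fun τ s t h1 h2 x => hS.comp hF h1 h2 x, ?_⟩
  rintro ⟨t, τ, x⟩ hτ
  set M := max (b / (1 - k)) (‖x‖ + 1)
  obtain ⟨L, hL⟩ := hF.lipschitz M
  have hxM : ‖x‖ + 1 ≤ M := le_max_right _ _
  refine tendsto_iff_dist_tendsto_zero.2 ?_
  let Φ : ℝ × ℝ × X → ℝ := fun z => (b + 2 * M) * |z.1 - t| +
    ((b + 2 * M) * |z.2.1 - τ| + dist z.2.2 x) *
      Real.exp ((1 + L) * (max z.1 t - max z.2.1 τ))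
  have hΦ : Tendsto Φ (𝓝[{z | z.2.1 ≤ z.1}] (t, τ, x)) (𝓝 0) := by
    have hc : Continuous Φ := by fun_prop
    have h0 : Φ (t, τ, x) = 0 := by simp [Φ]
    rw [← h0]
    exact (hc.tendsto _).mono_left nhdsWithin_le_nhds
  refine squeeze_zero' (Eventually.of_forall fun _ => dist_nonneg) ?_ hΦ
  have hnear : ∀ᶠ z : ℝ × ℝ × X in 𝓝[{z | z.2.1 ≤ z.1}] (t, τ, x), ‖z.2.2‖ < ‖x‖ + 1 := by
    have hc : Continuous fun z : ℝ × ℝ × X => ‖z.2.2‖ := by fun_prop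
    exact ((hc.tendsto (t, τ, x)).mono_left nhdsWithin_le_nhds).eventually
      (gt_mem_nhds (by simp))
  filter_upwards [hnear, self_mem_nhdsWithin] with z hz hz'
  exact hS.dist_le_of_norm_le hF hL (le_max_left _ _) hz' hτ (by linarith) (by linarith)

end Semiflow

/-! ### The pullback attractor of a damped equation -/

/-- The pullback limit at time `t` of a set `B`. For `B` positively invariant the sets in the
intersection decrease with `τ`, so that this is the pullback `ω`-limit set of `B`. -/
def pullbackLimit {X : Type*} [NormedAddCommGroup X] (S : ℝ → ℝ → X → X) (B : Set X) (t : ℝ) :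
    Set X :=
  ⋂ τ ∈ Iic t, closure (S t τ '' B)

/-- A point of the pullback limit is a limit of states started from the ball at any prescribed
sequence of times. -/
lemma exists_tendsto_of_mem_pullbackLimit {X : Type*} [NormedAddCommGroup X] {S : ℝ → ℝ → X → X}
    {M t : ℝ} {τ : ℕ → ℝ} (hτ : ∀ n, τ n ≤ t) {y : X}
    (hy : y ∈ pullbackLimit S (Metric.closedBall 0 M) t) :
    ∃ x : ℕ → X, (∀ n, ‖x n‖ ≤ M) ∧ Tendsto (fun n => S t (τ n) (x n)) atTop (𝓝 y) := by
  have : ∀ n : ℕ, ∃ x : X, ‖x‖ ≤ M ∧ dist y (S t (τ n) x) < 1 / ((n : ℝ) + 1) := by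
    intro n
    obtain ⟨_, ⟨x, hx, rfl⟩, hd⟩ :=
      Metric.mem_closure_iff.1 (mem_iInter₂.1 hy (τ n) (hτ n)) (1 / ((n : ℝ) + 1)) (by positivity)
    exact ⟨x, mem_closedBall_zero_iff.1 hx, hd⟩
  choose x hx hd using this
  refine ⟨x, hx, tendsto_iff_dist_tendsto_zero.2 ?_⟩
  refine squeeze_zero (fun _ => dist_nonneg) (fun n => ?_) tendsto_one_div_add_atTop_nhds_zero_nat
  rw [dist_comm]
  exact (hd n).le

section Attractor

variable {X : Type*} [NormedAddCommGroup X] [NormedSpace ℝ X] {F : ℝ → X → X} {b k : ℝ}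
  {S : ℝ → ℝ → X → X}

/-- Variation of constants: apart from the decaying contribution of the initial state, the solution
stays in every closed convex set that contains `0` and the values of `F` on an invariant ball. The
integral in the variation of constants formula is avoided by testing with the functionals that
separate a point from the convex set. -/
lemma IsSolutionFamily.sub_exp_smul_mem (hS : IsSolutionFamily F S)
    (hF : IsDissipativeField F b k) {D : Set X} (hDc : Convex ℝ D) (hDcl : IsClosed D)
    (hD0 : (0 : X) ∈ D) {M : ℝ} (hM : b / (1 - k) ≤ M) (hD : ∀ s u, ‖u‖ ≤ M → F s u ∈ D)
    {τ t : ℝ} (hτ : τ ≤ t) {x : X} (hx : ‖x‖ ≤ M) :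
    S t τ x - Real.exp (τ - t) • x ∈ D := by
  by_contra hnot
  obtain ⟨l, c, hlD, hcl⟩ := geometric_hahn_banach_closed_point hDc hDcl hnot
  have hc : 0 < c := by simpa using hlD 0 hD0
  have htraj := (hS.trajectory τ x).mono (Icc_subset_Ici_self : Icc τ t ⊆ Ici τ)
  have hexp : ∀ s : ℝ, HasDerivAt (fun s : ℝ => Real.exp (s - t)) (Real.exp (s - t)) s :=
    fun s => by simpa using ((hasDerivAt_id s).sub_const t).exp
  have key := image_le_of_deriv_right_le_deriv_boundary
    (f := fun s => l (Real.exp (s - t) • S s τ x))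
    (f' := fun s => l (Real.exp (s - t) • F s (S s τ x)))
    (B := fun s => l (Real.exp (τ - t) • x) + c * (Real.exp (s - t) - Real.exp (τ - t)))
    (B' := fun s => c * Real.exp (s - t)) (a := τ) (b := t)
    (by
      have := htraj.continuousOn
      fun_prop)
    (by
      intro s hs
      have := (hexp s).hasDerivWithinAt.smul (htraj.hasDerivWithinAt_Ici hs)
      have h2 := l.hasFDerivAt.comp_hasDerivWithinAt s this
      convert! h2 using 1
      congr 1
      module)
    (by simp [hS.self])
    (by fun_prop)
    (by
      intro s hs
      exact ((((hexp s).sub_const _).const_mul c).const_add _).hasDerivWithinAt)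
    (by
      intro s hs
      rw [map_smul, smul_eq_mul, mul_comm c]
      exact mul_le_mul_of_nonneg_left
        (hlD _ (hD s _ (hS.norm_le_of_le hF hs.1 hM hx))).le (Real.exp_pos _).le)
    (⟨hτ, le_rfl⟩ : t ∈ Icc τ t)
  simp only [sub_self, Real.exp_zero, one_smul] at key
  rw [map_sub] at hcl
  nlinarith [Real.exp_pos (τ - t)]

/-- Pullback asymptotic compactness. -/
lemma IsSolutionFamily.exists_subseq_tendsto [CompleteSpace X] (hS : IsSolutionFamily F S)
    (hF : IsDissipativeField F b k) {M : ℝ} (hM : b / (1 - k) ≤ M) {t : ℝ} {τ : ℕ → ℝ}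
    (hτ : ∀ n, τ n ≤ t) (hlim : Tendsto τ atTop atBot) {x : ℕ → X} (hx : ∀ n, ‖x n‖ ≤ M) :
    ∃ y, ∃ φ : ℕ → ℕ, StrictMono φ ∧ Tendsto (fun n => S t (τ (φ n)) (x (φ n))) atTop (𝓝 y) := by
  set D := closure (convexHull ℝ (insert 0 {v | ∃ t u, ‖u‖ ≤ M ∧ F t u = v}))
  have hsub : insert 0 {v | ∃ t u, ‖u‖ ≤ M ∧ F t u = v} ⊆ D :=
    (subset_convexHull ℝ _).trans subset_closure
  have hDcl : IsClosed D := isClosed_closure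
  have hDcomp : IsCompact D :=
    (totallyBounded_convexHull.2 ((hF.totallyBounded M).insert 0)).closure.isCompact_of_isClosed
      hDcl
  have hmem : ∀ n, S t (τ n) (x n) - Real.exp (τ n - t) • x n ∈ D := fun n =>
    hS.sub_exp_smul_mem hF (convex_convexHull ℝ _).closure hDcl (hsub (mem_insert _ _)) hM
      (fun s u hu => hsub (mem_insert_of_mem _ ⟨s, u, hu, rfl⟩)) (hτ n) (hx n)
  obtain ⟨y, -, φ, hφ, hy⟩ := hDcomp.tendsto_subseq hmem
  have h0 : Tendsto (fun n => Real.exp (τ n - t) • x n) atTop (𝓝 0) := by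
    have he : Tendsto (fun n => Real.exp (τ n - t) * M) atTop (𝓝 0) := by
      have : Tendsto (fun n => Real.exp (τ n - t)) atTop (𝓝 0) :=
        Real.tendsto_exp_atBot.comp (tendsto_atBot_add_const_right _ (-t) hlim)
      simpa using this.mul_const M
    refine squeeze_zero_norm (fun n => ?_) he
    rw [norm_smul, Real.norm_eq_abs, abs_of_pos (Real.exp_pos _)]
    exact mul_le_mul_of_nonneg_left (hx n) (Real.exp_pos _).le
  refine ⟨y, φ, hφ, ?_⟩
  simpa using! hy.add (h0.comp hφ.tendsto_atTop)

lemma IsSolutionFamily.continuous (hS : IsSolutionFamily F S)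
    (hF : IsDissipativeField F b k) {τ t : ℝ} (hτ : τ ≤ t) : Continuous (S t τ) := by
  have h := (hS.isEvolutionProcess hF).continuousOn
  exact h.comp_continuous (f := fun x : X => (t, τ, x)) (by fun_prop) fun _ => hτ

lemma IsSolutionFamily.image_subset_image (hS : IsSolutionFamily F S)
    (hF : IsDissipativeField F b k) {M : ℝ} (hM : b / (1 - k) ≤ M) {σ τ t : ℝ} (hσ : σ ≤ τ)
    (hτ : τ ≤ t) :
    S t σ '' Metric.closedBall 0 M ⊆ S t τ '' Metric.closedBall 0 M := by
  rintro _ ⟨x, hx, rfl⟩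
  rw [hS.comp hF hσ hτ]
  rw [mem_closedBall_zero_iff] at hx
  exact mem_image_of_mem _ (mem_closedBall_zero_iff.2 (hS.norm_le_of_le hF hσ hM hx))

/-- Limits of states started from the ball at times tending to `-∞` lie in the pullback limit. -/
lemma IsSolutionFamily.mem_pullbackLimit_of_tendsto (hS : IsSolutionFamily F S)
    (hF : IsDissipativeField F b k) {M : ℝ} (hM : b / (1 - k) ≤ M) {t : ℝ} {τ : ℕ → ℝ}
    (hlim : Tendsto τ atTop atBot) {x : ℕ → X} (hx : ∀ n, ‖x n‖ ≤ M) {y : X}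
    (hy : Tendsto (fun n => S t (τ n) (x n)) atTop (𝓝 y)) :
    y ∈ pullbackLimit S (Metric.closedBall 0 M) t := by
  refine mem_iInter₂.2 fun σ hσ => mem_closure_of_tendsto hy ?_
  filter_upwards [hlim.eventually (eventually_le_atBot σ)] with n hn
  exact hS.image_subset_image hF hM hn hσ
    (mem_image_of_mem _ (mem_closedBall_zero_iff.2 (hx n)))

lemma tendsto_sub_natCast_atBot (t : ℝ) : Tendsto (fun n : ℕ => t - n) atTop atBot :=
  tendsto_atBot_add_const_left _ t (tendsto_neg_atTop_atBot.comp tendsto_natCast_atTop_atTop)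

/-- Every bounded set is carried into each ball of radius larger than the equilibrium bound within
a time that depends on the bounded set only. -/
lemma IsSolutionFamily.exists_absorbing_time (hS : IsSolutionFamily F S)
    (hF : IsDissipativeField F b k) {C : Set X} (hC : Bornology.IsBounded C) {δ : ℝ}
    (hδ : 0 < δ) :
    ∃ T : ℝ, 0 ≤ T ∧ ∀ τ, ∀ x ∈ C, ‖S (τ + T) τ x‖ ≤ b / (1 - k) + δ := by
  have hk : 0 < 1 - k := by linarith [hF.k_lt_one]
  obtain ⟨R, hR⟩ := hC.exists_norm_le
  have hρ : 0 ≤ b / (1 - k) := div_nonneg hF.b_nonneg hk.le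
  have hlim : Tendsto (fun T : ℝ => R * Real.exp (-(1 - k) * T)) atTop (𝓝 0) := by
    have : Tendsto (fun T : ℝ => Real.exp (-(1 - k) * T)) atTop (𝓝 0) :=
      Real.tendsto_exp_atBot.comp (tendsto_id.const_mul_atTop_of_neg (by linarith))
    simpa using this.const_mul R
  obtain ⟨T, hT, hT0⟩ := ((hlim.eventually (gt_mem_nhds hδ)).and (eventually_ge_atTop 0)).exists
  refine ⟨T, hT0, fun τ x hx => ?_⟩
  have := hS.norm_le hF (τ := τ) (t := τ + T) (d := R) (by linarith) (x := x)
    (by linarith [hR x hx])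
  rw [add_sub_cancel_left] at this
  linarith

lemma IsSolutionFamily.pullbackLimit_subset_closedBall (hS : IsSolutionFamily F S)
    (hF : IsDissipativeField F b k) (t : ℝ) :
    pullbackLimit S (Metric.closedBall 0 (b / (1 - k) + 1)) t ⊆
      Metric.closedBall 0 (b / (1 - k)) := by
  intro y hy
  rw [mem_closedBall_zero_iff]
  refine le_of_forall_pos_le_add fun δ hδ => ?_
  obtain ⟨T, hT0, hT⟩ := hS.exists_absorbing_time hF
    (Metric.isBounded_closedBall (x := (0 : X)) (r := b / (1 - k) + 1)) hδ
  have hsub : S t (t - T) '' Metric.closedBall 0 (b / (1 - k) + 1) ⊆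
      Metric.closedBall 0 (b / (1 - k) + δ) := by
    rintro _ ⟨x, hx, rfl⟩
    simpa using hT (t - T) x hx
  have := closure_minimal hsub Metric.isClosed_closedBall
    (mem_iInter₂.1 hy (t - T) (by simpa using hT0))
  simpa using this

variable [CompleteSpace X]

lemma IsSolutionFamily.isCompact_pullbackLimit (hS : IsSolutionFamily F S)
    (hF : IsDissipativeField F b k) {M : ℝ} (hM : b / (1 - k) ≤ M) (t : ℝ) :
    IsCompact (pullbackLimit S (Metric.closedBall 0 M) t) := by
  have hcl : IsClosed (pullbackLimit S (Metric.closedBall 0 M) t) :=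
    isClosed_biInter fun _ _ => isClosed_closure
  refine IsSeqCompact.isCompact fun y hy => ?_
  have hτ : ∀ n : ℕ, t - n ≤ t := fun n => by simp
  -- Each `y n` is approximated by a state started at time `t - n`.
  have : ∀ n : ℕ, ∃ x : X, ‖x‖ ≤ M ∧ dist (y n) (S t (t - n) x) < 1 / ((n : ℝ) + 1) := by
    intro n
    obtain ⟨_, ⟨x, hx, rfl⟩, hd⟩ := Metric.mem_closure_iff.1
      (mem_iInter₂.1 (hy n) (t - n) (hτ n)) (1 / ((n : ℝ) + 1)) (by positivity)
    exact ⟨x, mem_closedBall_zero_iff.1 hx, hd⟩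
  choose x hx hd using this
  obtain ⟨a, φ, hφ, ha⟩ := hS.exists_subseq_tendsto hF hM hτ (tendsto_sub_natCast_atBot t) hx
  have hd0 : Tendsto (fun n : ℕ => dist (S t (t - n) (x n)) (y n)) atTop (𝓝 0) :=
    squeeze_zero (fun _ => dist_nonneg) (fun n => by rw [dist_comm]; exact (hd n).le)
      tendsto_one_div_add_atTop_nhds_zero_nat
  have hya : Tendsto (y ∘ φ) atTop (𝓝 a) :=
    (tendsto_iff_of_dist (hd0.comp hφ.tendsto_atTop)).1 ha
  exact ⟨a, hcl.mem_of_tendsto hya (Eventually.of_forall fun n => hy _), φ, hφ, hya⟩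

lemma IsSolutionFamily.image_pullbackLimit (hS : IsSolutionFamily F S)
    (hF : IsDissipativeField F b k) {M : ℝ} (hM : b / (1 - k) ≤ M) {τ t : ℝ} (hτ : τ ≤ t) :
    S t τ '' pullbackLimit S (Metric.closedBall 0 M) τ =
      pullbackLimit S (Metric.closedBall 0 M) t := by
  have hσ : ∀ n : ℕ, τ - n ≤ τ := fun n => by simp
  have hlim := tendsto_sub_natCast_atBot τ
  apply Subset.antisymm
  · rintro _ ⟨y, hy, rfl⟩
    obtain ⟨x, hx, hxy⟩ := exists_tendsto_of_mem_pullbackLimit hσ hy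
    refine hS.mem_pullbackLimit_of_tendsto hF hM hlim hx ?_
    refine (((hS.continuous hF hτ).tendsto y).comp hxy).congr fun n => ?_
    exact (hS.comp hF (hσ n) hτ _).symm
  · intro y hy
    obtain ⟨x, hx, hxy⟩ :=
      exists_tendsto_of_mem_pullbackLimit (fun n => (hσ n).trans hτ) hy
    obtain ⟨z, φ, hφ, hz⟩ := hS.exists_subseq_tendsto hF hM hσ hlim hx
    refine ⟨z, hS.mem_pullbackLimit_of_tendsto hF hM (hlim.comp hφ.tendsto_atTop)
      (fun n => hx (φ n)) hz, ?_⟩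
    refine tendsto_nhds_unique (((hS.continuous hF hτ).tendsto z).comp hz)
      ((hxy.comp hφ.tendsto_atTop).congr fun n => ?_)
    exact hS.comp hF (hσ _) hτ _

/-- The pullback limit attracts the ball. -/
lemma IsSolutionFamily.eventually_infEDist_lt (hS : IsSolutionFamily F S)
    (hF : IsDissipativeField F b k) {M : ℝ} (hM : b / (1 - k) ≤ M) (t : ℝ) {ε : ℝ≥0∞}
    (hε : 0 < ε) :
    ∀ᶠ τ in atBot, ∀ x, ‖x‖ ≤ M →
      Metric.infEDist (S t τ x) (pullbackLimit S (Metric.closedBall 0 M) t) < ε := by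
  by_contra hnot
  rw [not_eventually] at hnot
  have : ∀ n : ℕ, ∃ τ ≤ t - n, ∃ x : X, ‖x‖ ≤ M ∧
      ε ≤ Metric.infEDist (S t τ x) (pullbackLimit S (Metric.closedBall 0 M) t) := by
    intro n
    obtain ⟨τ, h1, h2⟩ := (hnot.and_eventually (eventually_le_atBot (t - n))).exists
    push Not at h1
    exact ⟨τ, h2, h1⟩
  choose τ hτ x hx hfar using this
  have hlim : Tendsto τ atTop atBot := tendsto_atBot_mono hτ (tendsto_sub_natCast_atBot t)
  obtain ⟨y, φ, hφ, hy⟩ := hS.exists_subseq_tendsto hF hM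
    (fun n => (hτ n).trans (sub_le_self _ n.cast_nonneg)) hlim hx
  have hmem := hS.mem_pullbackLimit_of_tendsto hF hM (hlim.comp hφ.tendsto_atTop)
    (fun n => hx (φ n)) hy
  have h0 := (Metric.continuous_infEDist
    (s := pullbackLimit S (Metric.closedBall 0 M) t)).continuousAt.tendsto.comp hy
  rw [Metric.infEDist_zero_of_mem hmem] at h0
  exact absurd (ge_of_tendsto' h0 fun n => hfar (φ n)) (not_le.2 hε)

/-- The pullback limit of a ball slightly larger than the equilibrium bound is a pullback
attractor. -/
lemma IsSolutionFamily.isPullbackAttractor (hS : IsSolutionFamily F S)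
    (hF : IsDissipativeField F b k) :
    IsPullbackAttractor S (pullbackLimit S (Metric.closedBall 0 (b / (1 - k) + 1))) := by
  have hM : b / (1 - k) ≤ b / (1 - k) + 1 := by linarith
  refine ⟨hS.isCompact_pullbackLimit hF hM, fun τ t h => hS.image_pullbackLimit hF hM h, ?_, ?_⟩
  · intro t C hC
    obtain ⟨T, hT0, hT⟩ := hS.exists_absorbing_time hF hC one_pos
    rw [ENNReal.tendsto_nhds_zero]
    intro ε hε
    have h1 := (tendsto_atBot_add_const_right atBot T tendsto_id).eventually
      (hS.eventually_infEDist_lt hF hM t hε)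
    filter_upwards [h1, eventually_le_atBot (t - T)] with τ hτ hτT
    refine iSup₂_le ?_
    rintro _ ⟨x, hx, rfl⟩
    rw [hS.comp hF (by linarith : τ ≤ τ + T) (by linarith) x]
    exact (hτ _ (hT τ x hx)).le
  · intro C hCcl hC t y hy
    have hbdd : Bornology.IsBounded (Metric.closedBall (0 : X) (b / (1 - k) + 1)) :=
      Metric.isBounded_closedBall
    have hzero : Metric.infEDist y (C t) = 0 := by
      refine le_antisymm (ge_of_tendsto (hC t _ hbdd) ?_) zero_le
      filter_upwards [eventually_le_atBot t] with τ hτ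
      obtain ⟨x, hx, rfl⟩ := (hS.image_pullbackLimit hF hM hτ).symm ▸ hy
      refine le_iSup₂_of_le (S t τ x) (mem_image_of_mem _ ?_) le_rfl
      have := mem_iInter₂.1 hx τ self_mem_Iic
      have hid : S τ τ = id := funext fun x => hS.self τ x
      rwa [hid, image_id, Metric.isClosed_closedBall.closure_eq] at this
    exact (Metric.mem_iff_infEDist_zero_of_closed (hCcl t)).2 hzero

end Attractor

/-! ### Integral operators and reaction fields on `L^p` -/

/-- The integral operator with kernel `J` with respect to `μ`. For `μ` the restriction of the
volume to `Ω` this is `kernelOp Ω J`. -/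
noncomputable def integralOp {α : Type*} [MeasurableSpace α] (μ : Measure α) (J : α → α → ℝ)
    (u : α → ℝ) (x : α) : ℝ :=
  ∫ y, J x y * u y ∂μ

/-- A nonnegative kernel with total mass at most one in each variable, whose rows are bounded
in `L^q`. -/
structure IsAveragingKernel {α : Type*} [MeasurableSpace α] (μ : Measure α) (J : α → α → ℝ)
    (q : ℝ≥0∞) (C : ℝ≥0) : Prop where
  measurable : Measurable fun z : α × α => J z.1 z.2
  nonneg : ∀ x y, 0 ≤ J x y
  lintegral_right_le : ∀ x, ∫⁻ y, ENNReal.ofReal (J x y) ∂μ ≤ 1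
  lintegral_left_le : ∀ y, ∫⁻ x, ENNReal.ofReal (J x y) ∂μ ≤ 1
  eLpNorm_le : ∀ᵐ x ∂μ, eLpNorm (J x) q μ ≤ C

/-- A continuous reaction term of linear growth with slope below one, which is Lipschitz in the
state on bounded sets, uniformly in time. -/
structure IsSublinearReaction (g : ℝ → ℝ → ℝ) (b k : ℝ) : Prop where
  continuous : Continuous fun z : ℝ × ℝ => g z.1 z.2
  k_lt_one : k < 1
  growth : ∀ t x, |g t x| ≤ b + k * |x|
  lipschitz : ∀ R : ℝ, ∃ L : ℝ≥0, ∀ t, LipschitzOnWith L (g t) (Icc (-R) R)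

lemma IsSublinearReaction.k_nonneg {g : ℝ → ℝ → ℝ} {b k : ℝ} (hg : IsSublinearReaction g b k) :
    0 ≤ k := by
  by_contra hk
  push Not at hk
  -- A negative slope would make the bound negative for large states.
  have h1 := (abs_nonneg _).trans (hg.growth 0 ((|b| + 1) / (-k)))
  have h2 : 0 ≤ (|b| + 1) / (-k) := div_nonneg (by positivity) (by linarith)
  have h3 : k * ((|b| + 1) / (-k)) = -(|b| + 1) := by
    have : k ≠ 0 := hk.ne
    field_simp
  rw [abs_of_nonneg h2, h3] at h1
  linarith [le_abs_self b]

lemma IsSublinearReaction.b_nonneg {g : ℝ → ℝ → ℝ} {b k : ℝ} (hg : IsSublinearReaction g b k) :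
    0 ≤ b := by
  simpa using (abs_nonneg _).trans (hg.growth 0 0)

section Hoelder

variable {α : Type*} [MeasurableSpace α] {μ : Measure α}
  {E : Type*} [NormedAddCommGroup E] [NormedSpace ℝ E] {p q : ℝ≥0∞} [Fact (1 ≤ p)]

lemma lintegral_enorm_smul_le_of_eLpNorm_le [p.HolderConjugate q] {H : α → E}
    (hH : AEStronglyMeasurable H μ) {C : ℝ≥0} (hC : eLpNorm H q μ ≤ C) (u : Lp ℝ p μ) :
    ∫⁻ y, ‖u y • H y‖ₑ ∂μ ≤ ENNReal.ofReal (C * ‖u‖) := by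
  have h := eLpNorm_smul_le_mul_eLpNorm (p := p) (q := q) (r := 1) hH (Lp.aestronglyMeasurable u)
  rw [eLpNorm_one_eq_lintegral_enorm] at h
  refine h.trans ?_
  rw [ENNReal.ofReal_mul C.coe_nonneg, mul_comm, ← Lp.enorm_def, ofReal_norm,
    ENNReal.ofReal_coe_nnreal]
  gcongr

lemma integrable_smul_of_eLpNorm_le [p.HolderConjugate q] {H : α → E}
    (hH : AEStronglyMeasurable H μ) {C : ℝ≥0} (hC : eLpNorm H q μ ≤ C) (u : Lp ℝ p μ) :
    Integrable (fun y => u y • H y) μ :=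
  ⟨(Lp.aestronglyMeasurable u).smul hH,
    (lintegral_enorm_smul_le_of_eLpNorm_le hH hC u).trans_lt ENNReal.ofReal_lt_top⟩

lemma norm_integral_smul_le_of_eLpNorm_le [p.HolderConjugate q] {H : α → E}
    (hH : AEStronglyMeasurable H μ) {C : ℝ≥0} (hC : eLpNorm H q μ ≤ C) (u : Lp ℝ p μ) :
    ‖∫ y, u y • H y ∂μ‖ ≤ C * ‖u‖ := by
  have h := (enorm_integral_le_lintegral_enorm (μ := μ) fun y => u y • H y).trans
    (lintegral_enorm_smul_le_of_eLpNorm_le hH hC u)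
  rw [← ofReal_norm] at h
  exact (ENNReal.ofReal_le_ofReal_iff (by positivity)).1 h

end Hoelder

section Kernel

variable {α : Type*} [MeasurableSpace α] {μ : Measure α} {p q : ℝ≥0∞} {J : α → α → ℝ} {C : ℝ≥0}

/-- Jensen's inequality for a weight of mass at most one. -/
lemma enorm_integral_mul_le_eLpNorm_withDensity {j u : α → ℝ} (hj : Measurable j)
    (hj0 : ∀ y, 0 ≤ j y) (hmass : ∫⁻ y, ENNReal.ofReal (j y) ∂μ ≤ 1)
    (hu : AEStronglyMeasurable u μ) (hp : 1 ≤ p) :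
    ‖∫ y, j y * u y ∂μ‖ₑ ≤ eLpNorm u p (μ.withDensity fun y => ENNReal.ofReal (j y)) := by
  set ν := μ.withDensity fun y => ENNReal.ofReal (j y)
  have hν : ν ≪ μ := withDensity_absolutelyContinuous _ _
  have h1 : ‖∫ y, j y * u y ∂μ‖ₑ ≤ eLpNorm u 1 ν := by
    rw [eLpNorm_one_eq_lintegral_enorm,
      lintegral_withDensity_eq_lintegral_mul₀ hj.ennreal_ofReal.aemeasurable hu.enorm]
    refine (enorm_integral_le_lintegral_enorm _).trans_eq (lintegral_congr fun y => ?_)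
    rw [enorm_mul, Pi.mul_apply, Real.enorm_of_nonneg (hj0 y)]
  refine h1.trans ((eLpNorm_le_eLpNorm_mul_rpow_measure_univ hp (hu.mono_ac hν)).trans ?_)
  have hmass' : ν univ ≤ 1 := by
    rwa [withDensity_apply _ MeasurableSet.univ, Measure.restrict_univ]
  have hexp : 0 ≤ 1 / (1 : ℝ≥0∞).toReal - 1 / p.toReal := by
    rcases eq_or_ne p ∞ with rfl | hp'
    · simp
    · have : 1 ≤ p.toReal := by
        simpa using (ENNReal.toReal_le_toReal ENNReal.one_ne_top hp').2 hp
      have := (div_le_one (by linarith : 0 < p.toReal)).2 this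
      simpa using this
  calc _ ≤ eLpNorm u p ν * 1 := by
        gcongr
        exact ENNReal.rpow_le_one hmass' hexp
    _ = _ := mul_one _

/-- Hölder's inequality: the operator maps `L^p` into the essentially bounded functions. -/
lemma IsAveragingKernel.ae_abs_integralOp_le [Fact (1 ≤ p)] [p.HolderConjugate q]
    (hJ : IsAveragingKernel μ J q C) :
    ∀ᵐ x ∂μ, ∀ u : Lp ℝ p μ, |integralOp μ J u x| ≤ C * ‖u‖ := by
  filter_upwards [hJ.eLpNorm_le] with x hx u
  have := norm_integral_smul_le_of_eLpNorm_le
    (hJ.measurable.comp measurable_prodMk_left).aestronglyMeasurable hx u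
  simpa [integralOp, mul_comm] using! this

lemma IsAveragingKernel.ae_integralOp_sub [Fact (1 ≤ p)] [p.HolderConjugate q]
    (hJ : IsAveragingKernel μ J q C) (u v : Lp ℝ p μ) :
    ∀ᵐ x ∂μ, integralOp μ J (u - v : Lp ℝ p μ) x = integralOp μ J u x - integralOp μ J v x := by
  filter_upwards [hJ.eLpNorm_le] with x hx
  have hm : AEStronglyMeasurable (J x) μ :=
    (hJ.measurable.comp measurable_prodMk_left).aestronglyMeasurable
  have hint : ∀ w : Lp ℝ p μ, Integrable (fun y => J x y * w y) μ := fun w => by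
    simpa [mul_comm] using! integrable_smul_of_eLpNorm_le hm hx w
  rw [integralOp, integralOp, integralOp, ← integral_sub (hint u) (hint v)]
  refine integral_congr_ae ?_
  filter_upwards [Lp.coeFn_sub u v] with y hy
  rw [hy, Pi.sub_apply, mul_sub]

variable [SFinite μ]

lemma IsAveragingKernel.stronglyMeasurable_integralOp (hJ : IsAveragingKernel μ J q C)
    (u : Lp ℝ p μ) : StronglyMeasurable (integralOp μ J u) := by
  refine StronglyMeasurable.integral_prod_right' (f := fun z : α × α => J z.1 z.2 * u z.2) ?_
  exact hJ.measurable.stronglyMeasurable.mul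
    ((Lp.stronglyMeasurable u).comp_measurable measurable_snd)

/-- The operator is a contraction of `L^p`: Jensen's inequality on the rows, followed by Tonelli's
theorem and the mass bound on the columns. -/
lemma IsAveragingKernel.eLpNorm_integralOp_le (hJ : IsAveragingKernel μ J q C) (hp : 1 ≤ p)
    (u : Lp ℝ p μ) : eLpNorm (integralOp μ J u) p μ ≤ eLpNorm u p μ := by
  have hrow : ∀ x, Measurable (J x) := fun x => hJ.measurable.comp measurable_prodMk_left
  have hjensen : ∀ x, ‖integralOp μ J u x‖ₑ ≤
      eLpNorm u p (μ.withDensity fun y => ENNReal.ofReal (J x y)) := fun x =>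
    enorm_integral_mul_le_eLpNorm_withDensity (hrow x) (hJ.nonneg x) (hJ.lintegral_right_le x)
      (Lp.aestronglyMeasurable u) hp
  rcases eq_or_ne p ∞ with rfl | hp'
  · rw [eLpNorm_exponent_top]
    refine essSup_le_of_ae_le _ (Eventually.of_forall fun x => (hjensen x).trans ?_)
    rw [eLpNorm_exponent_top, eLpNorm_exponent_top]
    exact eLpNormEssSup_mono_measure _ (withDensity_absolutelyContinuous _ _)
  · have hp0 : p ≠ 0 := (zero_lt_one.trans_le hp).ne'
    have hr : 0 < p.toReal := ENNReal.toReal_pos hp0 hp'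
    have hum : Measurable fun y => ‖u y‖ₑ ^ p.toReal :=
      (Lp.stronglyMeasurable u).measurable.enorm.pow_const _
    rw [eLpNorm_eq_lintegral_rpow_enorm_toReal hp0 hp',
      eLpNorm_eq_lintegral_rpow_enorm_toReal hp0 hp']
    refine ENNReal.rpow_le_rpow ?_ (by positivity)
    calc ∫⁻ x, ‖integralOp μ J u x‖ₑ ^ p.toReal ∂μ
        ≤ ∫⁻ x, ∫⁻ y, ENNReal.ofReal (J x y) * ‖u y‖ₑ ^ p.toReal ∂μ ∂μ := by
          refine lintegral_mono fun x => ?_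
          refine (ENNReal.rpow_le_rpow (hjensen x) hr.le).trans_eq ?_
          rw [eLpNorm_eq_lintegral_rpow_enorm_toReal hp0 hp', ← ENNReal.rpow_mul,
            one_div_mul_cancel hr.ne', ENNReal.rpow_one,
            lintegral_withDensity_eq_lintegral_mul₀ (hrow x).ennreal_ofReal.aemeasurable
              hum.aemeasurable]
          rfl
      _ = ∫⁻ y, ∫⁻ x, ENNReal.ofReal (J x y) * ‖u y‖ₑ ^ p.toReal ∂μ ∂μ := by
          refine lintegral_lintegral_swap (Measurable.aemeasurable ?_)
          exact hJ.measurable.ennreal_ofReal.mul (hum.comp measurable_snd)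
      _ ≤ ∫⁻ y, ‖u y‖ₑ ^ p.toReal ∂μ := by
          refine lintegral_mono fun y => ?_
          have hcol : Measurable fun x => J x y := hJ.measurable.comp measurable_prodMk_right
          rw [lintegral_mul_const _ hcol.ennreal_ofReal]
          exact mul_le_of_le_one_left zero_le (hJ.lintegral_left_le y)

lemma IsAveragingKernel.memLp_integralOp (hJ : IsAveragingKernel μ J q C) (hp : 1 ≤ p)
    (u : Lp ℝ p μ) : MemLp (integralOp μ J u) p μ :=
  ⟨(hJ.stronglyMeasurable_integralOp u).aestronglyMeasurable,
    (hJ.eLpNorm_integralOp_le hp u).trans_lt (Lp.eLpNorm_lt_top u)⟩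

lemma IsAveragingKernel.norm_toLp_integralOp_le (hJ : IsAveragingKernel μ J q C) (hp : 1 ≤ p)
    (u : Lp ℝ p μ) : ‖(hJ.memLp_integralOp hp u).toLp _‖ ≤ ‖u‖ := by
  rw [Lp.norm_toLp, Lp.norm_def]
  exact ENNReal.toReal_mono (Lp.eLpNorm_ne_top u) (hJ.eLpNorm_integralOp_le hp u)

/-- The field `u ↦ g(t, K u)` on `L^p`, as an element of `L^p`. The default value `0` is not
used for averaging kernels and sublinear reactions on a finite measure space, where the composition
is essentially bounded. -/
noncomputable def reactionField (μ : Measure α) (p : ℝ≥0∞) (J : α → α → ℝ) (g : ℝ → ℝ → ℝ)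
    (t : ℝ) (u : Lp ℝ p μ) : Lp ℝ p μ :=
  open Classical in
  if h : MemLp (fun x => g t (integralOp μ J u x)) p μ then h.toLp _ else 0

end Kernel

section Reaction

variable {α : Type*} [MeasurableSpace α] {μ : Measure α} [IsFiniteMeasure μ] {p q : ℝ≥0∞}
  [Fact (1 ≤ p)]
  {J : α → α → ℝ} {C : ℝ≥0} {g : ℝ → ℝ → ℝ} {b k : ℝ}

lemma reactionField_ae_eq [p.HolderConjugate q] (hJ : IsAveragingKernel μ J q C)
    (hg : IsSublinearReaction g b k) (t : ℝ) (u : Lp ℝ p μ) :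
    ∀ᵐ x ∂μ, reactionField μ p J g t u x = g t (integralOp μ J u x) := by
  have hcont : Continuous (g t) := hg.continuous.comp (by fun_prop : Continuous fun x => (t, x))
  have h : MemLp (fun x => g t (integralOp μ J u x)) p μ := by
    refine MemLp.of_bound (hcont.comp_stronglyMeasurable
      (hJ.stronglyMeasurable_integralOp u)).aestronglyMeasurable (b + k * (C * ‖u‖)) ?_
    filter_upwards [hJ.ae_abs_integralOp_le (p := p)] with x hx
    exact (hg.growth t _).trans
      (add_le_add_right (mul_le_mul_of_nonneg_left (hx u) hg.k_nonneg) _)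
  rw [reactionField, dif_pos h]
  exact h.coeFn_toLp

lemma norm_reactionField_le [p.HolderConjugate q] (hJ : IsAveragingKernel μ J q C)
    (hg : IsSublinearReaction g b k) (t : ℝ) (u : Lp ℝ p μ) :
    ‖reactionField μ p J g t u‖ ≤ b * μ.real univ ^ (1 / p).toReal + k * ‖u‖ := by
  have hp : 1 ≤ p := Fact.out
  set w : Lp ℝ p μ := (hJ.memLp_integralOp hp u).toLp _
  have h1 : ‖reactionField μ p J g t u‖ ≤ ‖Lp.const p μ b + k • |w|‖ := by
    refine Lp.norm_le_norm_of_ae_le ?_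
    filter_upwards [reactionField_ae_eq hJ hg t u, Lp.coeFn_add (Lp.const p μ b) (k • |w|),
      Lp.coeFn_const p μ b, Lp.coeFn_smul k |w|, Lp.coeFn_abs w,
      (hJ.memLp_integralOp hp u).coeFn_toLp] with x hx h1 h2 h3 h4 h5
    rw [hx, h1, Pi.add_apply, h2, h3, Pi.smul_apply, h4, h5, Real.norm_eq_abs, Real.norm_eq_abs]
    exact (hg.growth t _).trans (le_abs_self _)
  refine h1.trans ((norm_add_le _ _).trans (add_le_add ?_ ?_))
  · refine (Lp.norm_const_le p μ b).trans_eq ?_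
    rw [Real.norm_of_nonneg hg.b_nonneg, one_div, one_div, ENNReal.toReal_inv]
  · rw [norm_smul, Real.norm_of_nonneg hg.k_nonneg, norm_abs_eq_norm]
    exact mul_le_mul_of_nonneg_left (hJ.norm_toLp_integralOp_le hp u) hg.k_nonneg

lemma exists_lipschitzOnWith_reactionField [p.HolderConjugate q]
    (hJ : IsAveragingKernel μ J q C) (hg : IsSublinearReaction g b k) (M : ℝ) :
    ∃ L : ℝ≥0, ∀ t, LipschitzOnWith L (reactionField μ p J g t) (Metric.closedBall 0 M) := by
  have hp : 1 ≤ p := Fact.out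
  obtain ⟨L, hL⟩ := hg.lipschitz (C * M)
  refine ⟨L, fun t => LipschitzOnWith.of_dist_le_mul fun u hu v hv => ?_⟩
  rw [mem_closedBall_zero_iff] at hu hv
  rw [dist_eq_norm, dist_eq_norm]
  set w : Lp ℝ p μ := (hJ.memLp_integralOp hp (u - v)).toLp _
  have h1 : ‖reactionField μ p J g t u - reactionField μ p J g t v‖ ≤ L * ‖w‖ := by
    refine Lp.norm_le_mul_norm_of_ae_le_mul ?_
    filter_upwards [reactionField_ae_eq hJ hg t u, reactionField_ae_eq hJ hg t v,
      Lp.coeFn_sub (reactionField μ p J g t u) (reactionField μ p J g t v),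
      (hJ.memLp_integralOp hp (u - v)).coeFn_toLp, hJ.ae_integralOp_sub u v,
      hJ.ae_abs_integralOp_le (p := p)] with x h1 h2 h3 h4 h5 h6
    rw [h3, Pi.sub_apply, h1, h2, h4, h5, ← dist_eq_norm, ← dist_eq_norm]
    have hmem : ∀ z : Lp ℝ p μ, ‖z‖ ≤ M → integralOp μ J z x ∈ Icc (-(C * M)) (C * M) :=
      fun z hz => abs_le.1 ((h6 z).trans (mul_le_mul_of_nonneg_left hz C.2))
    exact (hL t).dist_le_mul _ (hmem u hu) _ (hmem v hv)
  exact h1.trans (mul_le_mul_of_nonneg_left (hJ.norm_toLp_integralOp_le hp _) L.2)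

lemma continuous_reactionField_time [p.HolderConjugate q]
    (hJ : IsAveragingKernel μ J q C) (hg : IsSublinearReaction g b k) (u : Lp ℝ p μ) :
    Continuous fun t => reactionField μ p J g t u := by
  refine continuous_iff_continuousAt.2 fun t => Metric.tendsto_nhds.2 fun ε hε => ?_
  set V : ℝ := (measureUnivNNReal μ : ℝ) ^ p.toReal⁻¹
  have hV0 : 0 ≤ V := by positivity
  set δ := ε / (V + 1)
  have hδ : 0 < δ := by positivity
  have hclose : ∀ᶠ s in 𝓝 t, ∀ y ∈ Icc (-(C * ‖u‖)) (C * ‖u‖), |g s y - g t y| < δ := by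
    refine isCompact_Icc.eventually_forall_of_forall_eventually fun y _ => ?_
    have hc : Continuous fun z : ℝ × ℝ => |g z.1 z.2 - g t z.2| :=
      (hg.continuous.sub (hg.continuous.comp (by fun_prop : Continuous fun z : ℝ × ℝ =>
        (t, z.2)))).abs
    exact (hc.tendsto (t, y)).eventually (gt_mem_nhds (by simpa using hδ))
  filter_upwards [hclose] with s hs
  rw [dist_eq_norm]
  refine (Lp.norm_le_of_ae_bound hδ.le ?_).trans_lt (b := V * δ) ?_
  · filter_upwards [reactionField_ae_eq hJ hg s u, reactionField_ae_eq hJ hg t u,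
      Lp.coeFn_sub (reactionField μ p J g s u) (reactionField μ p J g t u),
      hJ.ae_abs_integralOp_le (p := p)] with x h1 h2 h3 h4
    rw [h3, Pi.sub_apply, h1, h2]
    exact (hs _ (abs_le.1 (h4 u))).le
  · have : (V + 1) * δ = ε := by simp only [δ]; field_simp
    linarith

end Reaction

/-! ### Mollification of functions with bounded weak gradient -/

section Mollify

variable {E : Type*} [NormedAddCommGroup E] [InnerProductSpace ℝ E] [FiniteDimensional ℝ E]
  [MeasurableSpace E] [BorelSpace E] {Ω : Set E} {f : E → ℝ} {C : ℝ}

/-- `f` has a weak gradient bounded by `C` on `Ω`, in the dual form: the distributional derivative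
in the direction `v` is a functional of norm at most `C ‖v‖` for the `L^1` norm on test functions.
-/
def HasBoundedWeakGradientOn (Ω : Set E) (f : E → ℝ) (C : ℝ) : Prop :=
  ∀ φ : E → ℝ, ContDiff ℝ ∞ φ → HasCompactSupport φ → tsupport φ ⊆ Ω → ∀ v : E,
    |∫ x in Ω, f x * fderiv ℝ φ x v| ≤ C * ‖v‖ * ∫ x in Ω, |φ x|

/-- The convolution with a bump function has, at each point whose distance to the complement of `Ω`
exceeds the radius of the bump, a derivative that is bounded by the weak gradient bound. -/
lemma HasBoundedWeakGradientOn.exists_hasFDerivAt_convolution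
    (hf : HasBoundedWeakGradientOn Ω f C) (hC : 0 ≤ C) (hΩ : MeasurableSet Ω)
    (hint : IntegrableOn f Ω) (φ : ContDiffBump (0 : E)) {x : E}
    (hx : Metric.closedBall x φ.rOut ⊆ Ω) :
    ∃ D : E →L[ℝ] ℝ, ‖D‖ ≤ C ∧ HasFDerivAt
      (convolution (φ.normed volume) (Ω.indicator f) (ContinuousLinearMap.lsmul ℝ ℝ) volume)
      D x := by
  set g := Ω.indicator f
  have hg : LocallyIntegrable g := ((integrable_indicator_iff hΩ).2 hint).locallyIntegrable
  set η : E → ℝ := φ.normed volume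
  have hηc : HasCompactSupport η := φ.hasCompactSupport_normed
  have hηs : ContDiff ℝ ∞ η := φ.contDiff_normed
  have hη1 : ContDiff ℝ 1 η := hηs.of_le (by simp)
  refine ⟨_, ContinuousLinearMap.opNorm_le_bound _ hC fun v => ?_,
    hηc.hasFDerivAt_convolution_left _ hη1 hg x⟩
  -- The reflected translate of the bump is the test function that represents the derivative.
  set ψ : E → ℝ := fun t => η (x - t) with hψ
  have hψs : ContDiff ℝ ∞ ψ := hηs.comp (contDiff_const.sub contDiff_id)
  have hsupp : tsupport ψ ⊆ Metric.closedBall x φ.rOut := by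
    refine closure_minimal (fun t ht => ?_) Metric.isClosed_closedBall
    have : x - t ∈ Function.support η := ht
    rw [φ.support_normed_eq, Metric.mem_ball, dist_zero_right] at this
    rw [Metric.mem_closedBall, dist_comm, dist_eq_norm]
    exact this.le
  have hψc : HasCompactSupport ψ :=
    HasCompactSupport.of_support_subset_isCompact (isCompact_closedBall x φ.rOut)
      (subset_closure.trans hsupp)
  have hderiv : ∀ t, fderiv ℝ ψ t v = - fderiv ℝ η (x - t) v := by
    intro t
    have h1 : HasFDerivAt η (fderiv ℝ η (x - t)) (x - t) :=
      (hη1.differentiable one_ne_zero _).hasFDerivAt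
    have h2 : HasFDerivAt (fun t => x - t) (-ContinuousLinearMap.id ℝ E) t :=
      (hasFDerivAt_id t).const_sub x
    have h3 : HasFDerivAt ψ ((fderiv ℝ η (x - t)).comp (-ContinuousLinearMap.id ℝ E)) t :=
      h1.comp t h2
    rw [h3.fderiv]
    simp
  have hval : (convolution (fderiv ℝ η) g
      ((ContinuousLinearMap.lsmul ℝ ℝ).precompL E) volume) x v =
      - ∫ t in Ω, f t * fderiv ℝ ψ t v := by
    have hconv : ConvolutionExistsAt (fderiv ℝ η) g x
        ((ContinuousLinearMap.lsmul ℝ ℝ).precompL E) volume :=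
      (hηc.fderiv ℝ).convolutionExists_left _ (hη1.continuous_fderiv one_ne_zero) hg x
    rw [convolution_def, ContinuousLinearMap.integral_apply hconv]
    simp only [ContinuousLinearMap.precompL_apply, ContinuousLinearMap.lsmul_apply, smul_eq_mul]
    rw [← integral_sub_left_eq_self (fun t => fderiv ℝ η t v * g (x - t)) volume x,
      ← integral_indicator hΩ, ← integral_neg]
    refine integral_congr_ae (Eventually.of_forall fun t => ?_)
    simp only [sub_sub_cancel, g]
    by_cases ht : t ∈ Ω
    · simp only [indicator_of_mem ht, hderiv]; ring
    · simp [indicator_of_notMem ht]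
  have hmass : ∫ t in Ω, |ψ t| ≤ 1 := by
    have hψ0 : ∀ t, 0 ≤ ψ t := fun t => φ.nonneg_normed _
    have h1 : ∫ t, ψ t = 1 := by
      rw [hψ, integral_sub_left_eq_self η volume x]
      exact φ.integral_normed
    simp only [abs_of_nonneg (hψ0 _)]
    rw [← h1]
    exact setIntegral_le_integral (hψs.continuous.integrable_of_hasCompactSupport hψc)
      (Eventually.of_forall hψ0)
  rw [hval, norm_neg, Real.norm_eq_abs]
  refine (hf ψ hψs hψc (hsupp.trans hx) v).trans ?_
  exact mul_le_of_le_one_right (by positivity) hmass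

/-- A function with weak gradient bounded by `C` is an almost everywhere limit of functions that
are eventually Lipschitz with constant `C` along each segment in `Ω`. -/
lemma HasBoundedWeakGradientOn.exists_approx (hf : HasBoundedWeakGradientOn Ω f C) (hC : 0 ≤ C)
    (hΩ : IsOpen Ω) (hint : IntegrableOn f Ω) :
    ∃ F : ℕ → E → ℝ, (∀ᵐ x ∂(volume.restrict Ω), Tendsto (fun n => F n x) atTop (𝓝 (f x))) ∧
      ∀ a b, segment ℝ a b ⊆ Ω → ∀ᶠ n in atTop, |F n b - F n a| ≤ C * dist a b := by
  have hr : ∀ n : ℕ, (0 : ℝ) < 1 / ((n : ℝ) + 1) := fun n => by positivity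
  let φ : ℕ → ContDiffBump (0 : E) := fun n =>
    ⟨1 / ((n : ℝ) + 1) / 2, 1 / ((n : ℝ) + 1), half_pos (hr n), half_lt_self (hr n)⟩
  have hφ : Tendsto (fun n => (φ n).rOut) atTop (𝓝 0) := tendsto_one_div_add_atTop_nhds_zero_nat
  refine ⟨fun n => convolution ((φ n).normed volume) (Ω.indicator f)
    (ContinuousLinearMap.lsmul ℝ ℝ) volume, ?_, fun a b hab => ?_⟩
  · have h := ContDiffBump.ae_convolution_tendsto_right_of_locallyIntegrable (μ := volume)
      (φ := φ) (l := atTop) (K := 2) hφ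
      (Eventually.of_forall fun n => le_of_eq (mul_div_cancel₀ _ two_ne_zero).symm)
      ((integrable_indicator_iff hΩ.measurableSet).2 hint).locallyIntegrable
    filter_upwards [ae_restrict_of_ae h, ae_restrict_mem hΩ.measurableSet] with x hx hxΩ
    rwa [indicator_of_mem hxΩ] at hx
  · have hcomp : IsCompact (segment ℝ a b) := by
      rw [segment_eq_image_lineMap]
      exact isCompact_Icc.image AffineMap.lineMap_continuous
    obtain ⟨δ, hδ, hsub⟩ := hcomp.exists_cthickening_subset_open hΩ hab
    filter_upwards [hφ.eventually (gt_mem_nhds hδ)] with n hn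
    have hball : ∀ x ∈ segment ℝ a b, Metric.closedBall x (φ n).rOut ⊆ Ω := fun x hx =>
      ((Metric.closedBall_subset_closedBall hn.le).trans
        (Metric.closedBall_subset_cthickening hx δ)).trans hsub
    choose! D hD hder using fun x hx =>
      hf.exists_hasFDerivAt_convolution hC hΩ.measurableSet hint (φ n) (hball x hx)
    have := (convex_segment a b).norm_image_sub_le_of_norm_hasFDerivWithin_le
      (fun x hx => (hder x hx).hasFDerivWithinAt) hD (left_mem_segment ℝ a b)
      (right_mem_segment ℝ a b)
    rwa [Real.norm_eq_abs, ← dist_eq_norm, dist_comm b a] at this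

end Mollify

/-! ### Intrinsic total boundedness of smooth bounded domains -/

/-- `x` and `y` are joined inside `Ω` by a path of length at most `ε` made of three segments. -/
def JoinedByShortPath {E : Type*} [NormedAddCommGroup E] [NormedSpace ℝ E] (Ω : Set E) (ε : ℝ)
    (x y : E) : Prop :=
  ∃ a b, segment ℝ x a ⊆ Ω ∧ segment ℝ a b ⊆ Ω ∧ segment ℝ b y ⊆ Ω ∧
    dist x a + dist a b + dist b y ≤ ε

lemma exists_ball_joinedByShortPath_of_mem {E : Type*} [NormedAddCommGroup E] [NormedSpace ℝ E]
    {Ω : Set E} (hΩ : IsOpen Ω) {x₀ : E} (hx₀ : x₀ ∈ Ω) {ε : ℝ} (hε : 0 < ε) :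
    ∃ δ > 0, ∀ x ∈ Metric.ball x₀ δ ∩ Ω, ∀ y ∈ Metric.ball x₀ δ ∩ Ω,
      JoinedByShortPath Ω ε x y := by
  obtain ⟨r, hr, hball⟩ := Metric.isOpen_iff.1 hΩ x₀ hx₀
  refine ⟨min r (ε / 2), by positivity, fun x hx y hy => ⟨x, y, ?_, ?_, ?_, ?_⟩⟩
  · rw [segment_same]; exact singleton_subset_iff.2 hx.2
  · exact ((convex_ball x₀ _).segment_subset hx.1 hy.1).trans
      ((Metric.ball_subset_ball (min_le_left _ _)).trans hball)
  · rw [segment_same]; exact singleton_subset_iff.2 hy.2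
  · have h1 := dist_triangle_right x y x₀
    have h2 := Metric.mem_ball.1 hx.1
    have h3 := Metric.mem_ball.1 hy.1
    have h4 := min_le_right r (ε / 2)
    simp only [dist_self]
    linarith

/-- Near a boundary point the domain contains, with each of its points, a short segment in a fixed
direction `v` in which the defining function decreases. Two nearby points are joined by going up
along `v`, then across, and down again; at the height `σ` the crossing stays in the domain because
the decrease `σ / 2` of the defining function outweighs its variation over the small ball. -/
lemma exists_ball_joinedByShortPath_of_boundary {E : Type*} [NormedAddCommGroup E]
    [NormedSpace ℝ E] {Ω U : Set E} {ρ : E → ℝ} {x₀ : E} {L : E →L[ℝ] ℝ} (hU : IsOpen U)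
    (hx₀ : x₀ ∈ U) (hρ : HasStrictFDerivAt ρ L x₀) (hL : L ≠ 0) (hΩU : Ω ∩ U = {y ∈ U | ρ y < 0})
    {ε : ℝ} (hε : 0 < ε) :
    ∃ δ > 0, ∀ x ∈ Metric.ball x₀ δ ∩ Ω, ∀ y ∈ Metric.ball x₀ δ ∩ Ω,
      JoinedByShortPath Ω ε x y := by
  obtain ⟨v, hv⟩ : ∃ v, L v = -1 := by
    obtain ⟨w, hw⟩ : ∃ w, L w ≠ 0 := by
      by_contra h
      push Not at h
      exact hL (ContinuousLinearMap.ext h)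
    exact ⟨(-(L w)⁻¹) • w, by simp [hw]⟩
  set c : ℝ≥0 := ⟨1 / (2 * (‖v‖ + 1)), by positivity⟩
  have hc : (0 : ℝ≥0) < c := by
    rw [← NNReal.coe_pos]
    change (0 : ℝ) < 1 / (2 * (‖v‖ + 1))
    positivity
  have hcv : (c : ℝ) * ‖v‖ ≤ 1 / 2 := by
    change 1 / (2 * (‖v‖ + 1)) * ‖v‖ ≤ 1 / 2
    rw [one_div_mul_eq_div, div_le_div_iff₀ (by positivity) two_pos]
    linarith [norm_nonneg v]
  obtain ⟨s, hs, happ⟩ := hρ.approximates_deriv_on_nhds (Or.inr hc)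
  obtain ⟨r, hr, hball⟩ := Metric.mem_nhds_iff.1 (inter_mem hs (hU.mem_nhds hx₀))
  have hstep : ∀ y ∈ Metric.ball x₀ r, ∀ z ∈ Metric.ball x₀ r, ∀ h : ℝ, 0 ≤ h →
      z + h • v ∈ Metric.ball x₀ r →
      ρ (z + h • v) ≤ ρ y + (‖L‖ + c) * dist z y - h / 2 := by
    intro y hy z hz h hh hzh
    have h1 := (le_abs_self _).trans (happ _ (hball hzh).1 _ (hball hy).1)
    have h2 : L (z + h • v - y) = L (z - y) - h := by
      rw [add_sub_right_comm, map_add, map_smul, hv]; simp; ring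
    have h3 : ‖z + h • v - y‖ ≤ dist z y + h * ‖v‖ := by
      rw [add_sub_right_comm, dist_eq_norm]
      refine (norm_add_le _ _).trans_eq ?_
      rw [norm_smul, Real.norm_of_nonneg hh]
    have h4 : L (z - y) ≤ ‖L‖ * dist z y := by
      rw [dist_eq_norm]
      exact (le_abs_self _).trans (L.le_opNorm _)
    rw [h2] at h1
    have h5 := mul_le_mul_of_nonneg_left h3 c.coe_nonneg
    have h6 := mul_le_mul_of_nonneg_left hcv hh
    linarith
  set m := min ε r
  have hm0 : 0 < m := by positivity
  set σ := m / (4 * (‖v‖ + 1)) with hσ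
  have hσ0 : 0 < σ := by positivity
  have hσv : σ * ‖v‖ ≤ m / 4 := by
    rw [hσ, div_mul_eq_mul_div, div_le_div_iff₀ (by positivity) (by norm_num)]
    nlinarith [norm_nonneg v]
  set δ := min (m / 4) (σ / (4 * (‖L‖ + c + 1)))
  have hδ0 : 0 < δ := by positivity
  have hδm : δ ≤ m / 4 := min_le_left _ _
  have hδσ : (‖L‖ + c) * (2 * δ) ≤ σ / 2 := by
    have h1 : δ ≤ σ / (4 * (‖L‖ + c + 1)) := min_le_right _ _
    rw [le_div_iff₀ (by positivity)] at h1
    nlinarith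
  have hmr : m ≤ r := min_le_right _ _
  have hmε : m ≤ ε := min_le_left _ _
  have hlift : ∀ z ∈ Metric.ball x₀ δ, ∀ h : ℝ, 0 ≤ h → h ≤ σ → z + h • v ∈ Metric.ball x₀ r := by
    intro z hz h h0 hh
    rw [Metric.mem_ball, dist_eq_norm] at hz ⊢
    have h1 : ‖z + h • v - x₀‖ ≤ ‖z - x₀‖ + h * ‖v‖ := by
      rw [add_sub_right_comm]
      refine (norm_add_le _ _).trans_eq ?_
      rw [norm_smul, Real.norm_of_nonneg h0]
    have h2 := mul_le_mul_of_nonneg_right hh (norm_nonneg v)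
    linarith
  have hδr : Metric.ball x₀ δ ⊆ Metric.ball x₀ r := Metric.ball_subset_ball (by linarith)
  have hmemΩ : ∀ z ∈ Metric.ball x₀ r, ρ z < 0 → z ∈ Ω := by
    intro z hz hneg
    have : z ∈ Ω ∩ U := by rw [hΩU]; exact ⟨(hball hz).2, hneg⟩
    exact this.1
  have hneg : ∀ z ∈ Metric.ball x₀ δ ∩ Ω, ρ z < 0 := by
    intro z hz
    have : z ∈ Ω ∩ U := ⟨hz.2, (hball (hδr hz.1)).2⟩
    rw [hΩU] at this
    exact this.2
  have hup : ∀ z ∈ Metric.ball x₀ δ ∩ Ω, segment ℝ z (z + σ • v) ⊆ Ω := by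
    intro z hz w hw
    obtain ⟨θ, hθ, rfl⟩ := (segment_eq_image' ℝ z (z + σ • v)) ▸ hw
    simp only [add_sub_cancel_left, smul_smul]
    have h0 : 0 ≤ θ * σ := mul_nonneg hθ.1 hσ0.le
    have hmem := hlift z hz.1 (θ * σ) h0 (mul_le_of_le_one_left hσ0.le hθ.2)
    refine hmemΩ _ hmem ?_
    have := hstep z (hδr hz.1) z (hδr hz.1) (θ * σ) h0 hmem
    rw [dist_self] at this
    linarith [hneg z hz]
  have hlen : ∀ z, dist z (z + σ • v) = σ * ‖v‖ := by
    intro z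
    rw [dist_self_add_right, norm_smul, Real.norm_of_nonneg hσ0.le]
  refine ⟨δ, hδ0, fun x hx y hy => ⟨x + σ • v, y + σ • v, hup x hx, ?_, ?_, ?_⟩⟩
  · intro w hw
    obtain ⟨z, hz, rfl⟩ : ∃ z ∈ segment ℝ x y, z + σ • v = w := by
      refine ⟨w - σ • v, ?_, sub_add_cancel _ _⟩
      have := (mem_segment_translate ℝ (σ • v) (x := w - σ • v) (b := x) (c := y)).1
      apply this
      rwa [add_sub_cancel, add_comm _ x, add_comm _ y]
    have hzδ : z ∈ Metric.ball x₀ δ := (convex_ball x₀ δ).segment_subset hx.1 hy.1 hz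
    have hmem := hlift z hzδ σ hσ0.le le_rfl
    refine hmemΩ _ hmem ?_
    have h1 := hstep x (hδr hx.1) z (hδr hzδ) σ hσ0.le hmem
    have h2 : dist z x ≤ 2 * δ := by
      have := dist_triangle_right z x x₀
      have := Metric.mem_ball.1 hzδ
      have := Metric.mem_ball.1 hx.1
      linarith
    have h3 := mul_le_mul_of_nonneg_left h2 (by positivity : 0 ≤ ‖L‖ + c)
    linarith [hneg x hx]
  · rw [segment_symm]; exact hup y hy
  · rw [hlen, dist_add_right, dist_comm (y + σ • v) y, hlen]
    have := dist_triangle_right x y x₀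
    have := Metric.mem_ball.1 hx.1
    have := Metric.mem_ball.1 hy.1
    linarith

/-- A smooth bounded domain is totally bounded for its intrinsic path metric. -/
lemma IsSmoothBoundedDomain.exists_finite_cover {N : ℕ} {Ω : Set (EuclideanSpace ℝ (Fin N))}
    (hΩ : IsSmoothBoundedDomain Ω) {ε : ℝ} (hε : 0 < ε) :
    ∃ (n : ℕ) (A : Fin n → Set (EuclideanSpace ℝ (Fin N))), Ω ⊆ ⋃ i, A i ∧
      ∀ i, ∀ x ∈ A i ∩ Ω, ∀ y ∈ A i ∩ Ω, JoinedByShortPath Ω ε x y := by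
  have hloc : ∀ x₀ ∈ closure Ω, ∃ δ > 0, ∀ x ∈ Metric.ball x₀ δ ∩ Ω, ∀ y ∈ Metric.ball x₀ δ ∩ Ω,
      JoinedByShortPath Ω ε x y := by
    intro x₀ hx₀
    by_cases hmem : x₀ ∈ Ω
    · exact exists_ball_joinedByShortPath_of_mem hΩ.isOpen hmem hε
    · have hfr : x₀ ∈ frontier Ω := ⟨hx₀, by rwa [hΩ.isOpen.interior_eq]⟩
      obtain ⟨U, ρ, hU, hxU, hρ, hne, hΩU⟩ := hΩ.smooth_boundary x₀ hfr
      have hstrict := (hρ.contDiffAt (hU.mem_nhds hxU)).hasStrictFDerivAt (by simp)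
      exact exists_ball_joinedByShortPath_of_boundary hU hxU hstrict (hne x₀ hxU) hΩU hε
  choose! δ hδ hjoin using hloc
  obtain ⟨t, ht, hcover⟩ := hΩ.isBounded.isCompact_closure.elim_nhds_subcover
    (fun x => Metric.ball x (δ x)) fun x hx => Metric.ball_mem_nhds x (hδ x hx)
  refine ⟨t.card, fun i => Metric.ball (t.equivFin.symm i) (δ (t.equivFin.symm i)), ?_, ?_⟩
  · intro x hx
    obtain ⟨z, hz, hxz⟩ := mem_iUnion₂.1 (hcover (subset_closure hx))
    exact mem_iUnion.2 ⟨t.equivFin ⟨z, hz⟩, by simpa using hxz⟩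
  · intro i
    exact hjoin _ (ht _ (t.equivFin.symm i).2)

/-! ### Compactness of the reaction field -/

/-- A uniformly bounded family in `L^p` is totally bounded if for each `η` the space has a finite
cover such that each member of the family oscillates by at most `η` on each piece, off a null set.
Rounding one value per piece leaves finitely many possibilities. -/
lemma totallyBounded_Lp_of_oscillation {α : Type*} [MeasurableSpace α] {μ : Measure α}
    [IsFiniteMeasure μ] {p : ℝ≥0∞} [Fact (1 ≤ p)] {𝓕 : Set (Lp ℝ p μ)} {R : ℝ}
    (hR : ∀ f ∈ 𝓕, ∀ᵐ x ∂μ, |f x| ≤ R)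
    (hosc : ∀ η > 0, ∃ (n : ℕ) (A : Fin n → Set α), (∀ᵐ x ∂μ, x ∈ ⋃ i, A i) ∧
      ∀ f ∈ 𝓕, ∃ T ∈ ae μ, ∀ i, ∀ x ∈ A i ∩ T, ∀ y ∈ A i ∩ T, |f x - f y| ≤ η) :
    TotallyBounded 𝓕 := by
  refine Metric.totallyBounded_of_finite_discretization fun ε hε => ?_
  set V : ℝ := (measureUnivNNReal μ : ℝ) ^ p.toReal⁻¹
  have hV0 : 0 ≤ V := by positivity
  set η := ε / (3 * (V + 1)) with hη
  have hη0 : 0 < η := by positivity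
  obtain ⟨n, A, hA, hT⟩ := hosc η hη0
  have hvals : ∀ f : 𝓕, ∃ T ∈ ae μ, ∃ c : Fin n → ℝ, ∀ i, |c i| ≤ |R| ∧
      ∀ x ∈ A i ∩ T, |(f : Lp ℝ p μ) x - c i| ≤ η := by
    rintro ⟨f, hf⟩
    obtain ⟨T, hTae, hTosc⟩ := hT f hf
    have hTR : T ∩ {x | |f x| ≤ R} ∈ ae μ := inter_mem hTae (hR f hf)
    have : ∀ i, ∃ c : ℝ, |c| ≤ |R| ∧ ∀ x ∈ A i ∩ (T ∩ {x | |f x| ≤ R}), |f x - c| ≤ η := by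
      intro i
      by_cases hne : (A i ∩ (T ∩ {x | |f x| ≤ R})).Nonempty
      · obtain ⟨y, hyA, hyT, hyR⟩ := hne
        exact ⟨f y, le_trans hyR (le_abs_self R),
          fun x hx => hTosc i x ⟨hx.1, hx.2.1⟩ y ⟨hyA, hyT⟩⟩
      · exact ⟨0, by simp, fun x hx => absurd ⟨x, hx⟩ hne⟩
    choose c hc using this
    exact ⟨_, hTR, c, hc⟩
  choose T hT c hc using hvals
  have hfloor : ∀ f i, ⌊c f i / η⌋ ∈ Finset.Icc ⌊-|R| / η⌋ ⌊|R| / η⌋ := by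
    intro f i
    have h := abs_le.1 (hc f i).1
    rw [Finset.mem_Icc]
    exact ⟨Int.floor_le_floor (div_le_div_of_nonneg_right h.1 hη0.le),
      Int.floor_le_floor (div_le_div_of_nonneg_right h.2 hη0.le)⟩
  refine ⟨ULift (Fin n → Finset.Icc ⌊-|R| / η⌋ ⌊|R| / η⌋), inferInstance,
    fun f => ⟨fun i => ⟨⌊c f i / η⌋, hfloor f i⟩⟩, fun f f' hff' => ?_⟩
  have hcc : ∀ i, |c f i - c f' i| ≤ η := by
    intro i
    have h1 : ⌊c f i / η⌋ = ⌊c f' i / η⌋ :=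
      congrArg Subtype.val (congrFun (congrArg ULift.down hff') i)
    have h2 := Int.abs_sub_lt_one_of_floor_eq_floor h1
    rw [← sub_div, abs_div, abs_of_pos hη0, div_lt_one hη0] at h2
    exact h2.le
  rw [dist_eq_norm]
  refine (Lp.norm_le_of_ae_bound (C := 3 * η) (by positivity) ?_).trans_lt (b := V * (3 * η)) ?_
  · filter_upwards [hA, hT f, hT f', Lp.coeFn_sub (f : Lp ℝ p μ) f'] with x hx h1 h2 h3
    obtain ⟨i, hi⟩ := mem_iUnion.1 hx
    have h4 := (hc f i).2 x ⟨hi, h1⟩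
    have h5 := (hc f' i).2 x ⟨hi, h2⟩
    have h6 := hcc i
    rw [h3, Pi.sub_apply, Real.norm_eq_abs]
    rw [abs_le] at h4 h5 h6 ⊢
    constructor <;> linarith
  · have : (V + 1) * (3 * η) = ε := by rw [hη]; field_simp
    linarith

section Fubini

variable {α : Type*} [MeasurableSpace α] {μ : Measure α} [SFinite μ] {p q : ℝ≥0∞} [Fact (1 ≤ p)]
  {H : α → α → ℝ} {C : ℝ≥0}

lemma integrable_prod_mul_kernel [p.HolderConjugate q]
    (hH : Measurable fun z : α × α => H z.1 z.2) (hC : ∀ᵐ x ∂μ, eLpNorm (H x) q μ ≤ C)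
    (u : Lp ℝ p μ) {w : α → ℝ} (hw : Integrable w μ) :
    Integrable (fun z : α × α => w z.1 * (H z.1 z.2 * u z.2)) (μ.prod μ) := by
  have hm : AEStronglyMeasurable (fun z : α × α => w z.1 * (H z.1 z.2 * u z.2)) (μ.prod μ) :=
    hw.1.comp_fst.mul (hH.stronglyMeasurable.mul
      ((Lp.stronglyMeasurable u).comp_measurable measurable_snd)).aestronglyMeasurable
  refine ⟨hm, ?_⟩
  rw [HasFiniteIntegral, lintegral_prod _ hm.enorm]
  refine lt_of_le_of_lt (lintegral_mono_ae
    (g := fun x => ‖w x‖ₑ * ENNReal.ofReal (C * ‖u‖)) ?_) ?_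
  · filter_upwards [hC] with x hx
    have h := lintegral_enorm_smul_le_of_eLpNorm_le
      (hH.comp measurable_prodMk_left).aestronglyMeasurable hx u
    simp only [enorm_mul]
    rw [lintegral_const_mul' _ _ enorm_ne_top]
    gcongr
    refine le_trans (le_of_eq (lintegral_congr fun y => ?_)) h
    rw [enorm_smul, mul_comm]
    rfl
  · rw [lintegral_mul_const' _ _ ENNReal.ofReal_ne_top]
    exact ENNReal.mul_lt_top hw.2 ENNReal.ofReal_lt_top

/-- Fubini's theorem for the pairing of `integralOp μ H u` with a test function. -/
lemma integral_mul_integralOp [p.HolderConjugate q]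
    (hH : Measurable fun z : α × α => H z.1 z.2) (hC : ∀ᵐ x ∂μ, eLpNorm (H x) q μ ≤ C)
    (u : Lp ℝ p μ) {w : α → ℝ} (hw : Integrable w μ) :
    ∫ x, w x * integralOp μ H u x ∂μ = ∫ y, u y * ∫ x, w x * H x y ∂μ ∂μ := by
  simp only [integralOp, ← integral_const_mul]
  rw [integral_integral_swap (integrable_prod_mul_kernel hH hC u hw)]
  refine integral_congr_ae (Eventually.of_forall fun y => integral_congr_ae
    (Eventually.of_forall fun x => ?_))
  ring

end Fubini

/-- A function with weak gradient bounded by `D` varies by at most `D ε` between almost all points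
that are joined by short paths. -/
lemma HasBoundedWeakGradientOn.exists_ae_oscillation_le {E : Type*} [NormedAddCommGroup E]
    [InnerProductSpace ℝ E] [FiniteDimensional ℝ E] [MeasurableSpace E] [BorelSpace E] {Ω : Set E}
    {f : E → ℝ} {D : ℝ} (hf : HasBoundedWeakGradientOn Ω f D) (hD : 0 ≤ D) (hΩ : IsOpen Ω)
    (hint : IntegrableOn f Ω) :
    ∃ T ∈ ae (volume.restrict Ω), T ⊆ Ω ∧ ∀ ε, ∀ x ∈ T, ∀ y ∈ T, JoinedByShortPath Ω ε x y →
      |f x - f y| ≤ D * ε := by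
  obtain ⟨F, hF, hseg⟩ := hf.exists_approx hD hΩ hint
  refine ⟨{x | Tendsto (fun n => F n x) atTop (𝓝 (f x))} ∩ Ω,
    inter_mem hF (ae_restrict_mem hΩ.measurableSet), inter_subset_right, ?_⟩
  rintro ε x ⟨hx, -⟩ y ⟨hy, -⟩ ⟨a, b, h1, h2, h3, hlen⟩
  refine le_of_tendsto (hx.sub hy).abs ?_
  filter_upwards [hseg _ _ h1, hseg _ _ h2, hseg _ _ h3] with n e1 e2 e3
  have e4 := mul_le_mul_of_nonneg_left hlen hD
  rw [abs_le] at e1 e2 e3 ⊢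
  constructor <;> linarith

section Domain

variable {N : ℕ} {Ω : Set (EuclideanSpace ℝ (Fin N))} {p q : ℝ≥0∞} [Fact (1 ≤ p)]
  {J : EuclideanSpace ℝ (Fin N) → EuclideanSpace ℝ (Fin N) → ℝ}
  {Jx : EuclideanSpace ℝ (Fin N) → EuclideanSpace ℝ (Fin N) → EuclideanSpace ℝ (Fin N)}
  {C C' : ℝ≥0}

/-- The weak gradient of `K u` is the integral of the weak gradients of the kernel against `u`,
hence bounded by Hölder's inequality. -/
lemma hasBoundedWeakGradientOn_integralOp [p.HolderConjugate q]
    (hJ : IsAveragingKernel (volume.restrict Ω) J q C)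
    (hJx : Measurable fun z : EuclideanSpace ℝ (Fin N) × EuclideanSpace ℝ (Fin N) => Jx z.1 z.2)
    (hgrad : ∀ᵐ y ∂(volume.restrict Ω), HasWeakGradientOn Ω (fun x => J x y) (fun x => Jx x y))
    (hC' : ∀ᵐ x ∂(volume.restrict Ω), eLpNorm (Jx x) q (volume.restrict Ω) ≤ C')
    (u : Lp ℝ p (volume.restrict Ω)) :
    HasBoundedWeakGradientOn Ω (integralOp (volume.restrict Ω) J u) (C' * ‖u‖) := by
  intro φ hφ hφc hφΩ v
  set H : EuclideanSpace ℝ (Fin N) → EuclideanSpace ℝ (Fin N) → ℝ := fun x y => inner ℝ (Jx x y) v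
  have hH : Measurable fun z : EuclideanSpace ℝ (Fin N) × EuclideanSpace ℝ (Fin N) =>
      H z.1 z.2 := hJx.inner measurable_const
  have hHC : ∀ᵐ x ∂(volume.restrict Ω),
      eLpNorm (H x) q (volume.restrict Ω) ≤ (‖v‖₊ * C' : ℝ≥0) := by
    filter_upwards [hC'] with x hx
    refine (eLpNorm_le_nnreal_smul_eLpNorm_of_ae_le_mul (g := Jx x) (c := ‖v‖₊)
      (Eventually.of_forall fun y => ?_) q).trans ?_
    · rw [mul_comm]; exact nnnorm_inner_le_nnnorm _ _
    · rw [ENNReal.smul_def, smul_eq_mul, ENNReal.coe_mul]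
      gcongr
  have hφint : Integrable φ (volume.restrict Ω) :=
    (hφ.continuous.integrable_of_hasCompactSupport hφc).restrict
  have hDint : Integrable (fun x => fderiv ℝ φ x v) (volume.restrict Ω) := by
    have hc : Continuous fun x => fderiv ℝ φ x v :=
      (hφ.continuous_fderiv (by simp)).clm_apply continuous_const
    refine (hc.integrable_of_hasCompactSupport ?_).restrict
    exact (hφc.fderiv_apply ℝ v)
  have hparts : ∫ x, fderiv ℝ φ x v * integralOp (volume.restrict Ω) J u x ∂(volume.restrict Ω) =
      - ∫ x, φ x * integralOp (volume.restrict Ω) H u x ∂(volume.restrict Ω) := by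
    rw [integral_mul_integralOp hJ.measurable hJ.eLpNorm_le u hDint,
      integral_mul_integralOp hH hHC u hφint, ← integral_neg]
    refine integral_congr_ae ?_
    filter_upwards [hgrad] with y hy
    have h := hy.integral_eq φ hφ hφc hφΩ v
    simp only [mul_comm (J _ y)] at h
    change u y * ∫ x in Ω, fderiv ℝ φ x v * J x y = -(u y * ∫ x in Ω, φ x * inner ℝ (Jx x y) v)
    rw [h, mul_neg]
  have hbound : ∀ᵐ x ∂(volume.restrict Ω),
      |integralOp (volume.restrict Ω) H u x| ≤ C' * ‖u‖ * ‖v‖ := by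
    filter_upwards [hHC] with x hx
    have := norm_integral_smul_le_of_eLpNorm_le
      (hH.comp measurable_prodMk_left).aestronglyMeasurable hx u
    refine le_trans (le_of_eq ?_) (this.trans_eq ?_)
    · simp [integralOp, mul_comm]
    · push_cast; ring
  have hcomm : ∫ x in Ω, integralOp (volume.restrict Ω) J u x * fderiv ℝ φ x v =
      ∫ x, fderiv ℝ φ x v * integralOp (volume.restrict Ω) J u x ∂(volume.restrict Ω) :=
    integral_congr_ae (Eventually.of_forall fun x => mul_comm _ _)
  rw [hcomm, hparts, abs_neg, ← integral_const_mul, ← Real.norm_eq_abs]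
  refine norm_integral_le_of_norm_le (hφint.abs.const_mul _) ?_
  filter_upwards [hbound] with x hx
  rw [norm_mul, Real.norm_eq_abs, Real.norm_eq_abs, mul_comm]
  exact mul_le_mul_of_nonneg_right hx (abs_nonneg _)

lemma totallyBounded_reactionField [p.HolderConjugate q] (hΩ : IsSmoothBoundedDomain Ω)
    [IsFiniteMeasure (volume.restrict Ω)]
    (hJ : IsAveragingKernel (volume.restrict Ω) J q C)
    (hJx : Measurable fun z : EuclideanSpace ℝ (Fin N) × EuclideanSpace ℝ (Fin N) => Jx z.1 z.2)
    (hgrad : ∀ᵐ y ∂(volume.restrict Ω), HasWeakGradientOn Ω (fun x => J x y) (fun x => Jx x y))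
    (hC' : ∀ᵐ x ∂(volume.restrict Ω), eLpNorm (Jx x) q (volume.restrict Ω) ≤ C')
    {g : ℝ → ℝ → ℝ} {b k : ℝ} (hg : IsSublinearReaction g b k) (M : ℝ) :
    TotallyBounded {v | ∃ t u, ‖u‖ ≤ M ∧ reactionField (volume.restrict Ω) p J g t u = v} := by
  rcases lt_or_ge M 0 with hM | hM
  · convert totallyBounded_empty
    refine eq_empty_of_forall_notMem ?_
    rintro v ⟨t, u, hu, -⟩
    linarith [norm_nonneg u]
  set μ := volume.restrict Ω
  have hp : 1 ≤ p := Fact.out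
  obtain ⟨L, hL⟩ := hg.lipschitz (C * M)
  have hKR : ∀ᵐ x ∂μ, ∀ u : Lp ℝ p μ, ‖u‖ ≤ M → |integralOp μ J u x| ≤ C * M := by
    filter_upwards [hJ.ae_abs_integralOp_le (p := p)] with x hx u hu
    exact (hx u).trans (mul_le_mul_of_nonneg_left hu C.coe_nonneg)
  refine totallyBounded_Lp_of_oscillation (R := b + k * (C * M)) ?_ fun η hη => ?_
  · rintro _ ⟨t, u, hu, rfl⟩
    filter_upwards [reactionField_ae_eq hJ hg t u, hKR] with x hx hK
    rw [hx]
    exact (hg.growth t _).trans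
      (add_le_add_right (mul_le_mul_of_nonneg_left (hK u hu) hg.k_nonneg) _)
  · -- With this `ε` the product of `ε`, the gradient bound and the Lipschitz constant is below `η`.
    set ε := η / (L * (C' * M) + 1) with hε
    have hε0 : 0 < ε := by positivity
    obtain ⟨n, A, hA, hjoin⟩ := hΩ.exists_finite_cover hε0
    refine ⟨n, A, ?_, ?_⟩
    · filter_upwards [ae_restrict_mem hΩ.isOpen.measurableSet] with x hx using hA hx
    · rintro _ ⟨t, u, hu, rfl⟩
      have hint : IntegrableOn (integralOp μ J u) Ω := (hJ.memLp_integralOp hp u).integrable hp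
      obtain ⟨T, hT, hTΩ, hosc⟩ := (hasBoundedWeakGradientOn_integralOp hJ hJx hgrad hC'
        u).exists_ae_oscillation_le (by positivity) hΩ.isOpen hint
      refine ⟨_, inter_mem hT (inter_mem (reactionField_ae_eq hJ hg t u) hKR), ?_⟩
      rintro i x ⟨hxA, hxT, hx, hxK⟩ y ⟨hyA, hyT, hy, hyK⟩
      have h1 := hosc ε x hxT y hyT (hjoin i x ⟨hxA, hTΩ hxT⟩ y ⟨hyA, hTΩ hyT⟩)
      have h2 := (hL t).dist_le_mul _ (abs_le.1 (hxK u hu)) _ (abs_le.1 (hyK u hu))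
      rw [Real.dist_eq, Real.dist_eq] at h2
      rw [show _ = _ from hx, show _ = _ from hy]
      have h3 : C' * ‖u‖ * ε ≤ C' * M * ε := by gcongr
      have h4 : L * (C' * M * ε) ≤ η := by
        have : (L * (C' * M) + 1) * ε = η := by rw [hε]; field_simp
        nlinarith
      exact h2.trans ((mul_le_mul_of_nonneg_left (h1.trans h3) L.coe_nonneg).trans h4)

/-! ### The nonlocal equation -/

lemma isAveragingKernel_restrict
    (hJ_meas : Measurable (fun z : EuclideanSpace ℝ (Fin N) × EuclideanSpace ℝ (Fin N) =>
      J z.1 z.2))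
    (hJ_nonneg : ∀ x y, 0 ≤ J x y) (hJ_symm : ∀ x y, J x y = J y x) (hJ_int : ∀ x, ∫ y, J x y = 1)
    (hΩ : MeasurableSet Ω) (hJ_q : ∀ x ∈ Ω, eLpNorm (J x) q (volume.restrict Ω) ≤ C) :
    IsAveragingKernel (volume.restrict Ω) J q C := by
  have hrow : ∀ x, ∫⁻ y in Ω, ENNReal.ofReal (J x y) ≤ 1 := by
    intro x
    -- A function that is not integrable has integral zero.
    have hint : Integrable (J x) := by
      by_contra h
      simpa [integral_undef h] using hJ_int x
    refine (setLIntegral_le_lintegral _ _).trans ?_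
    rw [← ofReal_integral_eq_lintegral_ofReal hint (Eventually.of_forall (hJ_nonneg x)), hJ_int,
      ENNReal.ofReal_one]
  refine ⟨hJ_meas, hJ_nonneg, hrow, fun y => ?_, ?_⟩
  · simp only [hJ_symm _ y]
    exact hrow y
  · filter_upwards [ae_restrict_mem hΩ] with x hx using hJ_q x hx

lemma isSublinearReaction_of_contDiff {g : ℝ → ℝ → ℝ} {b k : ℝ}
    (hg : ContDiff ℝ 1 (fun z : ℝ × ℝ => g z.1 z.2)) (hk : k < 1)
    (hgrowth : ∀ t x, |g t x| ≤ b + k * |x|)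
    (hderiv : ∀ R : ℝ, ∃ M : ℝ, ∀ t x, |x| ≤ R → |deriv (g t) x| ≤ M) :
    IsSublinearReaction g b k := by
  refine ⟨hg.continuous, hk, hgrowth, fun R => ?_⟩
  obtain ⟨M, hM⟩ := hderiv R
  refine ⟨M.toNNReal, fun t => LipschitzOnWith.of_dist_le_mul fun x hx y hy => ?_⟩
  have hdiff : Differentiable ℝ (g t) :=
    (hg.differentiable one_ne_zero).comp (by fun_prop : Differentiable ℝ fun x : ℝ => (t, x))
  have := (convex_Icc (-R) R).norm_image_sub_le_of_norm_deriv_le (f := g t)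
    (fun z _ => hdiff z) (fun z hz => (hM t z (abs_le.2 hz)).trans (Real.le_coe_toNNReal M)) hy hx
  rwa [← dist_eq_norm, ← dist_eq_norm] at this

/-- Trajectories of the abstract equation are the solutions of the nonlocal equation. -/
lemma isTrajectory_reactionField_iff [p.HolderConjugate q]
    [IsFiniteMeasure (volume.restrict Ω)] (hJ : IsAveragingKernel (volume.restrict Ω) J q C)
    {g : ℝ → ℝ → ℝ} {b k : ℝ} (hg : IsSublinearReaction g b k) {I : Set ℝ}
    {u : ℝ → Lp ℝ p (volume.restrict Ω)} :
    IsTrajectory (reactionField (volume.restrict Ω) p J g) I u ↔ IsSolutionOn Ω p J g I u := by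
  have hae : ∀ t, ∀ᵐ x ∂(volume.restrict Ω),
      (-u t + reactionField (volume.restrict Ω) p J g t (u t) : Lp ℝ p (volume.restrict Ω)) x =
        -u t x + g t (kernelOp Ω J (u t) x) := by
    intro t
    filter_upwards [reactionField_ae_eq hJ hg t (u t), Lp.coeFn_neg (u t),
      Lp.coeFn_add (-u t) (reactionField (volume.restrict Ω) p J g t (u t))] with x h1 h2 h3
    rw [h3, Pi.add_apply, h2, h1, Pi.neg_apply]
    rfl
  constructor
  · intro h
    exact ⟨h.continuousOn, fun t ht => ⟨_, h t ht, hae t⟩⟩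
  · intro h t ht
    obtain ⟨v, hv, hvae⟩ := h.hasDeriv t ht
    have : v = -u t + reactionField (volume.restrict Ω) p J g t (u t) :=
      Lp.ext (by filter_upwards [hvae, hae t] with x h1 h2 using h1.trans h2.symm)
    rwa [← this]

end Domain

theorem theorem4p2 {N : ℕ} (hN : 1 ≤ N) (Ω : Set (EuclideanSpace ℝ (Fin N)))
    (hΩ : IsSmoothBoundedDomain Ω)
    (p q : ℝ≥0∞) [Fact (1 ≤ p)] (hpq : 1 / p + 1 / q = 1)
    (J : EuclideanSpace ℝ (Fin N) → EuclideanSpace ℝ (Fin N) → ℝ)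
    (hJ_meas : Measurable (fun z : EuclideanSpace ℝ (Fin N) × EuclideanSpace ℝ (Fin N) =>
      J z.1 z.2))
    (hJ_nonneg : ∀ x y, 0 ≤ J x y)
    (hJ_symm : ∀ x y, J x y = J y x)
    (hJ_int : ∀ x, ∫ y, J x y = 1)
    (hJ_q : ∃ C : ℝ≥0, ∀ x ∈ Ω, eLpNorm (J x) q (volume.restrict Ω) ≤ C)
    (Jx : EuclideanSpace ℝ (Fin N) → EuclideanSpace ℝ (Fin N) → EuclideanSpace ℝ (Fin N))
    (hJx_meas : Measurable (fun z : EuclideanSpace ℝ (Fin N) × EuclideanSpace ℝ (Fin N) =>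
      Jx z.1 z.2))
    (hJx_grad : ∀ᵐ y ∂(volume.restrict Ω),
      HasWeakGradientOn Ω (fun x => J x y) (fun x => Jx x y))
    (hJx_q : ∃ C : ℝ≥0, ∀ x ∈ Ω, eLpNorm (Jx x) q (volume.restrict Ω) ≤ C)
    (g : ℝ → ℝ → ℝ) (hg : ContDiff ℝ 1 (fun z : ℝ × ℝ => g z.1 z.2))
    (k₁ k₂ : ℝ) (hk₁ : k₁ < 1) (hg_growth : ∀ t x, |g t x| ≤ k₂ + k₁ * |x|)
    (hg_deriv : ∀ R : ℝ, ∃ M : ℝ, ∀ t x, |x| ≤ R → |deriv (g t) x| ≤ M) :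
    ∃ S : ℝ → ℝ → Lp ℝ p (volume.restrict Ω) → Lp ℝ p (volume.restrict Ω),
      IsGeneratedProcess Ω p J g S ∧
      ∃ A : ℝ → Set (Lp ℝ p (volume.restrict Ω)),
        IsPullbackAttractor S A ∧
        ∀ t, A t ⊆ Metric.closedBall 0
          (k₂ * volume.real Ω ^ (1 / p).toReal / (1 - k₁)) := by
  have : p.HolderConjugate q := ENNReal.holderConjugate_iff.2 (by simpa [one_div] using hpq)
  have : IsFiniteMeasure (volume.restrict Ω) :=
    ⟨by rw [Measure.restrict_apply_univ]; exact hΩ.isBounded.measure_lt_top⟩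
  obtain ⟨C, hC⟩ := hJ_q
  obtain ⟨C', hC'⟩ := hJx_q
  have hΩm := hΩ.isOpen.measurableSet
  have hJ := isAveragingKernel_restrict hJ_meas hJ_nonneg hJ_symm hJ_int hΩm hC
  have hR := isSublinearReaction_of_contDiff hg hk₁ hg_growth hg_deriv
  have hC'ae : ∀ᵐ x ∂(volume.restrict Ω), eLpNorm (Jx x) q (volume.restrict Ω) ≤ C' := by
    filter_upwards [ae_restrict_mem hΩm] with x hx using hC' x hx
  set b := k₂ * volume.real Ω ^ (1 / p).toReal
  have hF : IsDissipativeField (reactionField (volume.restrict Ω) p J g) b k₁ :=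
    { b_nonneg := mul_nonneg hR.b_nonneg (by positivity)
      k_nonneg := hR.k_nonneg
      k_lt_one := hk₁
      continuous_time := continuous_reactionField_time hJ hR
      lipschitz := exists_lipschitzOnWith_reactionField hJ hR
      growth := fun t u => by
        have h := norm_reactionField_le hJ hR t u
        rwa [measureReal_restrict_apply_univ] at h
      totallyBounded := totallyBounded_reactionField hΩ hJ hJx_meas hJx_grad hC'ae hR }
  obtain ⟨S, hS⟩ := hF.exists_isSolutionFamily
  refine ⟨S, ⟨hS.isEvolutionProcess hF, fun τ u₀ =>
    (isTrajectory_reactionField_iff hJ hR).1 (hS.trajectory τ u₀), ?_⟩,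
    _, hS.isPullbackAttractor hF, hS.pullbackLimit_subset_closedBall hF⟩
  rintro τ s u₀ - w hw rfl t ht
  exact hS.eq_of_trajectory hF ht.1 (((isTrajectory_reactionField_iff hJ hR).2 hw).mono
    (Icc_subset_Ico_right ht.2))
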